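/- For $d\in\mathbb{N}$, a topological space $X$ has dimension at most $d$ if every open covering of $X$ has an open refinement such that every point lies in at most $d+1$ of its members; $\dim X$ is the least such $d$. Let $\mathrm{M}_n$ be the space of complex $n\times n$ matrices, $\mathrm{M}_n^{\mathrm{sa}}$ the subset of self-adjoint ones, and $\mathrm{U}_n$ the unitary group. A matrix is called positive if it is positive semidefinite, and negative if its opposite is positive. Let $\|\cdot\|_F$ denote the Frobenius norm and $\|\cdot\|$ the operator norm on $\mathrm{M}_n$. A continuous field of projections $e:X\to\mathrm{M}_n$ is called trivial if its range is a trivial vector bundle, i.e. if there are $m$ and continuous maps $v_1,\dots,v_m:X\to\mathbb{C}^n$ such that $v_1(x),\dots,v_m(x)$ is an orthonormal basis of $e(x)\mathbb{C}^n$ for all $x\in X$. **Theorem.** Let $d\in\mathbb{N}$, let $X$ be a normal space with $\dim X=d$ (no separation axiom beyond normality is assumed), let $c=\lceil d/2\rceil+1$, let $n>c$ and $k=n-c$. Let $f\in \mathrm{C}(X,\mathrm{M}_n^{\mathrm{sa}})$ and $\epsilon\in\mathrm{C}(X,\mathbb{R}_{>0})$. Then there exist $u\in\mathrm{C}(X,\mathrm{U}_n)$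 and $g\in\mathrm{C}(X,\mathrm{M}_n^{\mathrm{sa}})$ with $$\|(ufu^*)(x)-g(x)\|\le\|(ufu^*)(x)-g(x)\|_F<\epsilon(x)\qquad\text{for all }x\in X,$$ such that for each of the three choices (1), (2), (3) below there exist $\lambda_1,\dots,\lambda_k\in\mathrm{C}(X,\mathbb{R})$, continuous fields $p_1,\dots,p_k$ of rank-one orthogonal projections in $\mathrm{M}_n$, and $r,q\in\mathrm{C}(X,\mathrm{M}_n^{\mathrm{sa}})$ satisfying: * $g=\lambda_1p_1+\cdots+\lambda_kp_k+r+q$; * $p_ip_j=0$ for $i\neq j$, and $p_ir=rp_i=0$ for all $i$; * $r=0_{k}\oplus r_c$ for some $r_c\in\mathrm{C}(X,\mathrm{M}_c^{\mathrm{sa}})$, i.e. $r$ is zero outside of the bottom-right $c\times c$ corner; * $p_1+\cdots+p_k$ is constant equal to $1_k\oplus 0_c$ (in particular it is trivial); * $\lambda_1(x)>\cdots>\lambda_k(x)$ for all $x\in X$; * the spectral projections of $q$ (for its positive, negative and zero eigenvalues) are trivial projection fields; * according to the choice: 1. for all $x\in X$, $q(x)$ has rank exactly $1$, is positive, and satisfies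 $\|q(x)\|_F\le\sqrt2\,(\|f(x)\|_F+\epsilon(x))$ and $\|q(x)\|\le 2(\|f(x)\|+\epsilon(x))$; or 2. for all $x\in X$, $q(x)$ has rank exactly $1$, is negative, and satisfies the same two norm bounds as in (1); moreover, if $f(x)$ is positive for all $x\in X$, then $r(x)$ is positive and $\lambda_1(x),\dots,\lambda_k(x)\ge0$ for all $x\in X$; or 3. for all $x\in X$, $q(x)$ has rank exactly $2$, trace $0$, and satisfies $\|q(x)\|_F\le\|f(x)\|_F+\epsilon(x)$ and $\|q(x)\|\le\|f(x)\|+\epsilon(x)$; moreover, if $f(x)$ is positive for all $x\in X$, then $r(x)$ is positive and $\lambda_1(x),\dots,\lambda_k(x)\ge0$ for all $x\in X$. -/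

import Mathlib

open scoped Matrix ComplexOrder

/-- Every open covering has an open refinement such that each point lies in at most `d + 1`
of its members. -/
def HasCoveringDimLE (X : Type*) [TopologicalSpace X] (d : ℕ) : Prop :=
  ∀ U : Set (Set X), (∀ A ∈ U, IsOpen A) → ⋃₀ U = Set.univ →
    ∃ V : Set (Set X), (∀ B ∈ V, IsOpen B) ∧ ⋃₀ V = Set.univ ∧
      (∀ B ∈ V, ∃ A ∈ U, B ⊆ A) ∧ ∀ x : X, {B ∈ V | x ∈ B}.encard ≤ d + 1

/-- The Lebesgue covering dimension: the least `d` such that `X` has dimension at most `d`,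
and `⊤` if there is none. -/
noncomputable def coveringDim (X : Type*) [TopologicalSpace X] : ℕ∞ :=
  ⨅ (d : ℕ) (_ : HasCoveringDimLE X d), (d : ℕ∞)

/-- The Frobenius (Hilbert-Schmidt) norm. -/
noncomputable def frobNorm {n : ℕ} (A : Matrix (Fin n) (Fin n) ℂ) : ℝ :=
  Real.sqrt (∑ i, ∑ j, ‖A i j‖ ^ 2)

/-- The operator norm for the Euclidean norm on `ℂⁿ`. -/
noncomputable def opNorm {n : ℕ} (A : Matrix (Fin n) (Fin n) ℂ) : ℝ :=
  ‖Matrix.toEuclideanCLM (n := Fin n) (𝕜 := ℂ) A‖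

/-- The block-diagonal matrix `a ⊕ b`, as an `n × n` matrix with `n = k + c`. -/
def blockSum {k c n : ℕ} (h : k + c = n) (a : Matrix (Fin k) (Fin k) ℂ)
    (b : Matrix (Fin c) (Fin c) ℂ) : Matrix (Fin n) (Fin n) ℂ :=
  Matrix.reindex (finSumFinEquiv.trans (finCongr h)) (finSumFinEquiv.trans (finCongr h))
    (Matrix.fromBlocks a 0 0 b)

/-- The spectral projection `χ_S(A)` of a self-adjoint matrix `A` (functional calculus with the
indicator function of `S`, which is continuous on the finite spectrum of `A`). -/
noncomputable def spectralProj {n : ℕ} (S : Set ℝ) (A : Matrix (Fin n) (Fin n) ℂ) :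
    Matrix (Fin n) (Fin n) ℂ :=
  cfc (S.indicator fun _ => (1 : ℝ)) A

/-- The projection field `e` is trivial: its range is a trivial vector bundle. In other words,
there is a continuous field of orthonormal bases (the columns of `v x`) of the ranges of
the `e x`. -/
def IsTrivialProjField {X : Type*} [TopologicalSpace X] {n : ℕ}
    (e : X → Matrix (Fin n) (Fin n) ℂ) : Prop :=
  ∃ (m : ℕ) (v : C(X, Matrix (Fin n) (Fin m) ℂ)),
    ∀ x, (v x)ᴴ * v x = 1 ∧ v x * (v x)ᴴ = e x

/-- The decomposition `g = ∑ λ i p i + r + q`, with the properties which do not depend on the type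
of `q`. -/
structure IsFieldDecomposition {X : Type*} [TopologicalSpace X] {k c n : ℕ} (h : k + c = n)
    (g : C(X, Matrix (Fin n) (Fin n) ℂ)) (lam : Fin k → C(X, ℝ))
    (p : Fin k → C(X, Matrix (Fin n) (Fin n) ℂ)) (r q : C(X, Matrix (Fin n) (Fin n) ℂ)) :
    Prop where
  eq_sum : ∀ x, g x = ∑ i, lam i x • p i x + r x + q x
  isStarProjection : ∀ i x, IsStarProjection (p i x)
  rank_eq_one : ∀ i x, (p i x).rank = 1
  orthogonal : ∀ i j, i ≠ j → ∀ x, p i x * p j x = 0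
  orthogonal_r : ∀ i x, p i x * r x = 0 ∧ r x * p i x = 0
  corner : ∃ rc : C(X, Matrix (Fin c) (Fin c) ℂ),
    (∀ x, (rc x).IsHermitian) ∧ ∀ x, r x = blockSum h 0 (rc x)
  q_isHermitian : ∀ x, (q x).IsHermitian
  q_spectral_trivial :
    IsTrivialProjField (fun x => spectralProj (Set.Ioi 0) (q x)) ∧
    IsTrivialProjField (fun x => spectralProj (Set.Iio 0) (q x)) ∧
    IsTrivialProjField (fun x => spectralProj {0} (q x))
  sum_trivial : IsTrivialProjField fun x => ∑ i, p i x
  sum_eq : ∀ x, ∑ i, p i x = blockSum h 1 0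
  strictAnti : ∀ x, StrictAnti fun i => lam i x

/-! The proof is Householder tridiagonalization carried out continuously over `X`. To rotate a
column `b` with values in `ℂ^(N+1)` onto the positive first axis by a unitary depending continuously
on `b`, it suffices that `b` avoid the nonpositive real multiples of the first basis vector. This
holds as soon as `(Im b₀, b₁, …, b_N)` has no zero. That map takes values in a real space of
dimension `2N + 1`, so when `d ≤ 2N` a small perturbation removes its zeros (`exists_ne_zero_near`,
`exists_unitary_mulVec_eq`). With `c = ⌈d/2⌉ + 1` the step can be repeated for `k = n - c` columns.
It yields `g` close to `u f u*`, tridiagonal in its first `k` columns and with positive subdiagonal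
entries there (`exists_tridiagonal`).

Only one entry `β > 0` and its mirror image then link the top `k × k` block to the bottom `c × c`
block. Let `q` be `β` times the constant matrix with rows `(t, 1)` and `(1, t)` in those two
coordinates. Its eigenvalues are `β (t ± 1)`, its eigenvectors do not depend on `x`, and `g - q` is
block diagonal. The values `t = 1, -1, 0` give the three choices.

The top block of `g - q` is a Jacobi matrix with nonzero subdiagonal, so its spectrum is simple.
Hence its ordered eigenvalues and its eigenprojections are unique, and by compactness continuous
(`continuous_eigenSystem`); these are the `λ i` and `p i`. The bottom block is `r`. -/

/-! ### Covering dimension and nowhere vanishing perturbations -/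

open MeasureTheory in
/-- A sequence in a finite-dimensional space has arbitrarily small translates none of whose
subfamilies of at most `finrank ℝ E` members has the origin in its affine span. -/
theorem exists_small_not_mem_affineSpan {E : Type*} [NormedAddCommGroup E] [NormedSpace ℝ E]
    [FiniteDimensional ℝ E] {d : ℕ} (hd : d < Module.finrank ℝ E) (y : ℕ → E) {δ : ℝ}
    (hδ : 0 < δ) :
    ∃ a : E, ‖a‖ < δ ∧
      ∀ S : Finset ℕ, S.card ≤ d + 1 → -a ∉ affineSpan ℝ (y '' (S : Set ℕ)) := by
  let _ : MeasurableSpace E := borel E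
  have : BorelSpace E := ⟨rfl⟩
  set T : Set E := ⋃ S : {S : Finset ℕ // S.card ≤ d + 1},
    (affineSpan ℝ (y '' (S.1 : Set ℕ)) : Set E) with hT
  have hnull : (Measure.addHaar : Measure E) T = 0 := by
    -- At most `d + 1` points span an affine subspace of dimension at most `d`, hence a proper and
    -- null one, and there are countably many finite sets `S`. The empty `S` is treated apart
    -- because the dimension bound is `S.card - 1`.
    refine measure_iUnion_null fun S => Measure.addHaar_affineSubspace _ _ fun htop => ?_
    rcases Nat.eq_zero_or_pos S.1.card with h0 | h0
    · rw [Finset.card_eq_zero] at h0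
      rw [h0] at htop
      simp at htop
    · classical
      have h1 := finrank_vectorSpan_image_finset_le ℝ y S.1
        (n := S.1.card - 1) (by omega)
      rw [Finset.coe_image, ← direction_affineSpan, htop, AffineSubspace.direction_top,
        finrank_top] at h1
      have := S.2
      omega
  have hball : ¬ Metric.ball (0 : E) δ ⊆ T := fun hsub =>
    (Metric.measure_ball_pos (Measure.addHaar : Measure E) (0 : E) hδ).ne'
      (measure_mono_null hsub hnull)
  obtain ⟨z, hz, hzT⟩ := Set.not_subset.1 hball
  refine ⟨-z, by simpa using hz, fun S hS hmem => hzT ?_⟩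
  rw [neg_neg] at hmem
  exact Set.mem_iUnion.2 ⟨⟨S, hS⟩, hmem⟩

/-- An indexed, locally finite form of the covering dimension, with a partition of unity. -/
theorem HasCoveringDimLE.exists_partitionOfUnity {X : Type*} [TopologicalSpace X] [NormalSpace X]
    {d : ℕ} (hX : HasCoveringDimLE X d) {ι : Type*} (U : ι → Set X) (hUo : ∀ i, IsOpen (U i))
    (hUf : LocallyFinite U) (hU : ⋃ i, U i = Set.univ) :
    ∃ φ : PartitionOfUnity ι X, (∀ i, tsupport (φ i) ⊆ U i) ∧
      ∀ x, (φ.finsupport x).card ≤ d + 1 := by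
  obtain ⟨V, hVo, hVu, hVU, hVd⟩ := hX (Set.range U) (by rintro _ ⟨i, rfl⟩; exact hUo i)
    (by rw [Set.sUnion_range, hU])
  have hidx : ∀ B : V, ∃ i, B.1 ⊆ U i := fun B => by
    obtain ⟨_, ⟨i, rfl⟩, h⟩ := hVU B.1 B.2
    exact ⟨i, h⟩
  choose ix hix using hidx
  -- The refinement `V` need not be locally finite. Merging its members according to a chosen index
  -- gives a cover dominated by `U`, hence locally finite, without raising the multiplicity at any
  -- point.
  set W : ι → Set X := fun i => ⋃ B : {B : V // ix B = i}, B.1.1 with hW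
  have hWU : ∀ i, W i ⊆ U i := by
    intro i
    refine Set.iUnion_subset ?_
    rintro ⟨B, rfl⟩
    exact hix B
  have hWo : ∀ i, IsOpen (W i) := fun i => isOpen_iUnion fun B => hVo _ B.1.2
  have hWu : Set.univ ⊆ ⋃ i, W i := by
    intro x _
    have hx : x ∈ ⋃₀ V := hVu ▸ Set.mem_univ x
    obtain ⟨B, hB, hxB⟩ := hx
    exact Set.mem_iUnion.2 ⟨ix ⟨B, hB⟩, Set.mem_iUnion.2 ⟨⟨⟨B, hB⟩, rfl⟩, hxB⟩⟩
  obtain ⟨φ, hφ⟩ := PartitionOfUnity.exists_isSubordinate_of_locallyFinite isClosed_univ W hWo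
    (hUf.subset hWU) hWu
  refine ⟨φ, fun i => (hφ i).trans (hWU i), fun x => ?_⟩
  classical
  -- Each index active at `x` comes from a member of `V` containing `x`. Values in `Option ι` make
  -- the index map defined on all sets, even if `ι` is empty.
  have hsub : some '' ((φ.finsupport x : Finset ι) : Set ι) ⊆
      (fun B : Set X => if h : B ∈ V then some (ix ⟨B, h⟩) else none) '' {B ∈ V | x ∈ B} := by
    rintro _ ⟨i, hi, rfl⟩
    have hxi : x ∈ W i := hφ i (subset_tsupport _ (by simpa using hi))
    obtain ⟨⟨⟨B, hB⟩, rfl⟩, hxB⟩ := Set.mem_iUnion.1 hxi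
    exact ⟨B, ⟨hB, hxB⟩, by simp [hB]⟩
  have h3 := ((Set.encard_le_encard hsub).trans (Set.encard_image_le _ _)).trans (hVd x)
  rw [(Option.some_injective ι).encard_image, Set.encard_coe_eq_coe_finsetCard] at h3
  exact_mod_cast h3

/-- On a normal space of covering dimension at most `d`, a map to a vector space of dimension
greater than `d` can be perturbed to a nowhere vanishing map. -/
theorem HasCoveringDimLE.exists_ne_zero_near {X : Type*} [TopologicalSpace X] [NormalSpace X]
    {d : ℕ} (hX : HasCoveringDimLE X d) {E : Type*} [NormedAddCommGroup E] [NormedSpace ℝ E]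
    [FiniteDimensional ℝ E] (hd : d < Module.finrank ℝ E) (F : C(X, E)) {δ : ℝ} (hδ : 0 < δ) :
    ∃ G : C(X, E), (∀ x, G x ≠ 0) ∧ ∀ x, ‖F x - G x‖ < δ := by
  have : ProperSpace E := FiniteDimensional.proper ℝ E
  set y : ℕ → E := TopologicalSpace.denseSeq E
  -- The locally finite refinement is taken in `E`, which is paracompact, and pulled back by `F`;
  -- normality of `X` would not provide one.
  obtain ⟨v, hvo, hvu, hvf, hvy⟩ := precise_refinement (fun i => Metric.ball (y i) (δ / 2))
    (fun i => Metric.isOpen_ball) (by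
      refine Set.eq_univ_of_forall fun z => ?_
      obtain ⟨i, hi⟩ := (TopologicalSpace.denseRange_denseSeq E).exists_dist_lt z (half_pos hδ)
      exact Set.mem_iUnion.2 ⟨i, hi⟩)
  obtain ⟨φ, hφ, hφd⟩ := hX.exists_partitionOfUnity (fun i => F ⁻¹' v i)
    (fun i => (hvo i).preimage F.continuous) (hvf.preimage_continuous F.continuous)
    (by rw [← Set.preimage_iUnion, hvu, Set.preimage_univ])
  obtain ⟨a, ha, hspan⟩ := exists_small_not_mem_affineSpan hd y (half_pos hδ)
  have hsum : ∀ x, ∑ᶠ i, φ i x • (y i + a) = (∑ i ∈ φ.finsupport x, φ i x • y i) + a := by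
    intro x
    rw [← φ.sum_finsupport_smul_eq_finsum fun i _ => y i + a]
    simp only [smul_add, Finset.sum_add_distrib, ← Finset.sum_smul,
      φ.sum_finsupport (Set.mem_univ x), one_smul]
  refine ⟨⟨fun x => ∑ᶠ i, φ i x • (y i + a), ?_⟩, fun x hx => ?_, fun x => ?_⟩
  · exact φ.continuous_finsum_smul fun i x _ => continuousAt_const
  -- A zero would express `-a` as an affine combination of at most `d + 1` of the points `y i`,
  -- which the choice of `a` excludes.
  · rw [ContinuousMap.coe_mk, hsum] at hx
    refine hspan (φ.finsupport x) (hφd x) ?_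
    rw [← eq_neg_of_add_eq_zero_left hx]
    have := affineCombination_mem_affineSpan_image (k := ℝ) (s := φ.finsupport x)
      (w := fun i => φ i x) (φ.sum_finsupport (Set.mem_univ x))
      (s' := (φ.finsupport x : Set ℕ)) (fun i hi hn => absurd hi hn) y
    rwa [Finset.affineCombination_eq_linear_combination _ _ _
      (φ.sum_finsupport (Set.mem_univ x))] at this
  · rw [ContinuousMap.coe_mk]
    -- Every active `y i + a` is within `δ / 2 + δ / 2` of `F x`, and balls are convex.
    have h1 : ∑ᶠ i, φ i x • (y i + a) ∈ Metric.ball (F x) δ := by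
      refine (convex_ball (F x) δ).finsum_mem (fun i => φ.nonneg i x)
        (φ.sum_eq_one (Set.mem_univ x)) fun i hi => ?_
      have h2 : F x ∈ Metric.ball (y i) (δ / 2) :=
        hvy i (hφ i (subset_tsupport _ (by simpa using hi)))
      rw [mem_ball_iff_norm, norm_sub_rev] at h2
      rw [mem_ball_iff_norm, add_sub_right_comm]
      linarith [norm_add_le (y i - F x) a]
    rwa [mem_ball_iff_norm, norm_sub_rev] at h1

/-! ### Continuous Householder reflections -/

/-- The Euclidean length of a complex vector. -/
noncomputable def vecLen {m : ℕ} (b : Fin m → ℂ) : ℝ := Real.sqrt (∑ i, ‖b i‖ ^ 2)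

theorem vecLen_sq {m : ℕ} (b : Fin m → ℂ) : vecLen b ^ 2 = ∑ i, ‖b i‖ ^ 2 :=
  Real.sq_sqrt (by positivity)

theorem star_dotProduct_self_eq {m : ℕ} (b : Fin m → ℂ) :
    star b ⬝ᵥ b = ((∑ i, ‖b i‖ ^ 2 : ℝ) : ℂ) := by
  simp [dotProduct, Complex.conj_mul']

theorem sum_norm_sq_unitary_mulVec {m : ℕ} {U : Matrix (Fin m) (Fin m) ℂ}
    (hU : U ∈ Matrix.unitaryGroup (Fin m) ℂ) (b : Fin m → ℂ) :
    ∑ i, ‖(U *ᵥ b) i‖ ^ 2 = ∑ i, ‖b i‖ ^ 2 := by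
  have h : star (U *ᵥ b) ⬝ᵥ (U *ᵥ b) = star b ⬝ᵥ b := by
    rw [Matrix.star_mulVec, ← Matrix.dotProduct_mulVec, Matrix.mulVec_mulVec,
      ← Matrix.star_eq_conjTranspose, Matrix.mem_unitaryGroup_iff'.1 hU, Matrix.one_mulVec]
  rw [star_dotProduct_self_eq, star_dotProduct_self_eq] at h
  exact_mod_cast h

/-- The vector orthogonal to the mirror of the (complex) Householder reflection taking `b` to a
multiple of the first basis vector. -/
noncomputable def householderVec {m : ℕ} (b : Fin (m + 1) → ℂ) : Fin (m + 1) → ℂ :=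
  b + Pi.single 0 (vecLen b : ℂ)

/-- A unitary matrix depending continuously on `b` and taking `b` to a positive multiple of the
first basis vector, provided that `b` is not a nonpositive multiple of it. -/
noncomputable def householder {m : ℕ} (b : Fin (m + 1) → ℂ) :
    Matrix (Fin (m + 1)) (Fin (m + 1)) ℂ :=
  (star (householderVec b) ⬝ᵥ b)⁻¹ •
    Matrix.vecMulVec (householderVec b) (star (householderVec b)) - 1

/-- Since `|b 0| ≤ vecLen b`, this formula shows that the denominator in `householder` vanishes
exactly when `b` is a nonpositive real multiple of the first basis vector. -/
theorem star_householderVec_dotProduct {m : ℕ} (b : Fin (m + 1) → ℂ) :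
    star (householderVec b) ⬝ᵥ b = vecLen b * (vecLen b + b 0) := by
  rw [householderVec, star_add, add_dotProduct, star_dotProduct_self_eq, ← vecLen_sq,
    ← Pi.single_star, single_dotProduct]
  simp
  ring

theorem star_householderVec_dotProduct_self {m : ℕ} (b : Fin (m + 1) → ℂ) :
    star (householderVec b) ⬝ᵥ householderVec b =
      star (householderVec b) ⬝ᵥ b + star (star (householderVec b) ⬝ᵥ b) := by
  rw [star_householderVec_dotProduct]
  nth_rewrite 2 [householderVec]
  rw [dotProduct_add, star_householderVec_dotProduct]
  simp [householderVec]
  ring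

theorem householder_mulVec {m : ℕ} {b : Fin (m + 1) → ℂ}
    (hb : star (householderVec b) ⬝ᵥ b ≠ 0) :
    householder b *ᵥ b = Pi.single 0 (vecLen b : ℂ) := by
  rw [householder, Matrix.sub_mulVec, Matrix.smul_mulVec, Matrix.vecMulVec_mulVec,
    Matrix.one_mulVec, op_smul_eq_smul, smul_smul, inv_mul_cancel₀ hb, one_smul, householderVec,
    add_sub_cancel_left]

/-- For a vector `v` and a scalar `t ≠ 0`, the matrix `t⁻¹ v v* - 1` is unitary as soon as `|v|² = t
+ star t`, which `star_householderVec_dotProduct_self` provides. -/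
theorem householder_mem_unitaryGroup {m : ℕ} {b : Fin (m + 1) → ℂ}
    (hb : star (householderVec b) ⬝ᵥ b ≠ 0) :
    householder b ∈ Matrix.unitaryGroup (Fin (m + 1)) ℂ := by
  rw [Matrix.mem_unitaryGroup_iff]
  have hs := star_householderVec_dotProduct_self b
  have hb' : star (star (householderVec b) ⬝ᵥ b) ≠ 0 := star_ne_zero.2 hb
  rw [householder]
  generalize star (householderVec b) ⬝ᵥ b = t at *
  generalize householderVec b = v at *
  have h1 : star (Matrix.vecMulVec v (star v)) = Matrix.vecMulVec v (star v) := by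
    rw [Matrix.star_eq_conjTranspose, Matrix.conjTranspose_vecMulVec, star_star]
  rw [star_sub, star_smul, h1, star_one, sub_mul, mul_sub, mul_sub, one_mul, mul_one, mul_one,
    smul_mul_smul_comm, Matrix.vecMulVec_mul_vecMulVec, hs, Matrix.vecMulVec_smul, smul_smul,
    ← sub_add, ← sub_smul, ← sub_smul, add_eq_right]
  rw [star_inv₀]
  have : t⁻¹ * (star t)⁻¹ * (t + star t) - t⁻¹ - (star t)⁻¹ = 0 := by
    field_simp
    ring
  rw [this, zero_smul]

theorem continuous_householder {X : Type*} [TopologicalSpace X] {m : ℕ}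
    {b : X → Fin (m + 1) → ℂ} (hb : Continuous b)
    (h : ∀ x, star (householderVec (b x)) ⬝ᵥ b x ≠ 0) :
    Continuous fun x => householder (b x) := by
  have hlen : Continuous fun x => vecLen (b x) := by
    unfold vecLen
    fun_prop
  have hv : Continuous fun x => householderVec (b x) := by
    refine continuous_pi fun i => ?_
    by_cases hi : i = 0
    · subst hi
      simp only [householderVec, Pi.add_apply, Pi.single_eq_same]
      fun_prop
    · simp only [householderVec, Pi.add_apply, Pi.single_eq_of_ne hi]
      fun_prop
  unfold householder
  refine (((hv.star.dotProduct hb).inv₀ h).smul (hv.matrix_vecMulVec hv.star)).sub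
    continuous_const

/-- Making `b` nonzero would not be enough: it must also miss the negative first axis. Leaving `Re
b₀` untouched and perturbing the remaining `2N + 1` real coordinates to a nowhere vanishing map
achieves both. -/
theorem HasCoveringDimLE.exists_unitary_mulVec_eq {X : Type*} [TopologicalSpace X] [NormalSpace X]
    {d : ℕ} (hX : HasCoveringDimLE X d) {N : ℕ} (hd : d ≤ 2 * N) (b : C(X, Fin (N + 1) → ℂ))
    {η : ℝ} (hη : 0 < η) :
    ∃ (s : C(X, ℝ)) (V : C(X, Matrix.unitaryGroup (Fin (N + 1)) ℂ)) (b' : C(X, Fin (N + 1) → ℂ)),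
      (∀ x, 0 < s x) ∧ (∀ x i, ‖b x i - b' x i‖ < η) ∧
      ∀ x, (V x : Matrix (Fin (N + 1)) (Fin (N + 1)) ℂ) *ᵥ b' x = Pi.single 0 (s x : ℂ) := by
  let F : C(X, ℝ × (Fin N → ℂ)) := ⟨fun x => ((b x 0).im, fun i => b x i.succ), by fun_prop⟩
  obtain ⟨G, hG0, hG⟩ := hX.exists_ne_zero_near (E := ℝ × (Fin N → ℂ))
    (by simp [Module.finrank_prod, Module.finrank_pi_fintype]; omega) F hη
  let b' : C(X, Fin (N + 1) → ℂ) :=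
    ⟨fun x => Fin.cons ((b x 0).re + (G x).1 * Complex.I) (G x).2, by
      refine continuous_pi fun i => ?_
      refine Fin.cases ?_ (fun i => ?_) i
      · simp only [Fin.cons_zero]
        fun_prop
      · simp only [Fin.cons_succ]
        fun_prop⟩
  have hb0 : ∀ x, b' x 0 = (b x 0).re + (G x).1 * Complex.I := fun x => rfl
  have hbs : ∀ x i, b' x (Fin.succ i) = (G x).2 i := fun x i => rfl
  have hpos : ∀ x, 0 < vecLen (b' x) := by
    intro x
    refine Real.sqrt_pos.2 (lt_of_le_of_ne (by positivity) fun h => hG0 x ?_)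
    have h0 := (Finset.sum_eq_zero_iff_of_nonneg fun i _ => by positivity).1 h.symm
    refine Prod.ext ?_ (funext fun i => ?_)
    · have := h0 0 (Finset.mem_univ _)
      rw [hb0] at this
      simpa using congrArg Complex.im (norm_eq_zero.1 (pow_eq_zero_iff two_ne_zero |>.1 this))
    · have := h0 i.succ (Finset.mem_univ _)
      rw [hbs] at this
      simpa using this
  -- Otherwise `b' x 0 = -vecLen (b' x)`: this entry is real and carries the full length, so the
  -- other entries vanish and `G x = 0`.
  have hne : ∀ x, star (householderVec (b' x)) ⬝ᵥ b' x ≠ 0 := by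
    intro x h
    rw [star_householderVec_dotProduct, mul_eq_zero, Complex.ofReal_eq_zero,
      or_iff_right (hpos x).ne'] at h
    have h0 : b' x 0 = -(vecLen (b' x) : ℂ) := (eq_neg_of_add_eq_zero_right h)
    have h1 : ∑ i : Fin N, ‖(G x).2 i‖ ^ 2 = 0 := by
      have := vecLen_sq (b' x)
      rw [Fin.sum_univ_succ, h0, norm_neg, Complex.norm_real, Real.norm_eq_abs, sq_abs] at this
      simpa [hbs] using this
    have h2 := (Finset.sum_eq_zero_iff_of_nonneg fun i _ => by positivity).1 h1
    refine hG0 x (Prod.ext ?_ (funext fun i => by simpa using h2 i (Finset.mem_univ _)))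
    rw [hb0] at h0
    simpa using congrArg Complex.im h0
  refine ⟨⟨fun x => vecLen (b' x), by unfold vecLen; fun_prop⟩,
    ⟨fun x => ⟨householder (b' x), householder_mem_unitaryGroup (hne x)⟩,
      (continuous_householder b'.continuous hne).subtype_mk _⟩, b', hpos, fun x i => ?_,
    fun x => householder_mulVec (hne x)⟩
  have hFG := hG x
  rw [Prod.norm_def, max_lt_iff] at hFG
  refine Fin.cases ?_ (fun i => ?_) i
  · have : b x 0 - b' x 0 = ((b x 0).im - (G x).1 : ℝ) * Complex.I := by
      rw [hb0]
      apply Complex.ext <;> simp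
    rw [this, norm_mul, Complex.norm_I, mul_one, Complex.norm_real]
    exact hFG.1
  · exact (norm_le_pi_norm ((F x - G x).2) i).trans_lt hFG.2

/-! ### Bordered matrices and tridiagonalization -/

/-- The Hermitian bordering of a square matrix `A` by a corner entry `a` and a first column `w`. -/
def border {m : ℕ} (a : ℂ) (w : Fin m → ℂ) (A : Matrix (Fin m) (Fin m) ℂ) :
    Matrix (Fin (m + 1)) (Fin (m + 1)) ℂ :=
  Matrix.of (Fin.cons (Fin.cons a (star w)) fun i => Fin.cons (w i) (A i))

section border

variable {m : ℕ} (a : ℂ) (w : Fin m → ℂ) (A : Matrix (Fin m) (Fin m) ℂ)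

@[simp] theorem border_zero_zero : border a w A 0 0 = a := rfl

@[simp] theorem border_zero_succ (j : Fin m) : border a w A 0 j.succ = star (w j) := rfl

@[simp] theorem border_succ_zero (i : Fin m) : border a w A i.succ 0 = w i := rfl

@[simp] theorem border_succ_succ (i j : Fin m) : border a w A i.succ j.succ = A i j := rfl

end border

theorem Matrix.ext_succ {m : ℕ} {A B : Matrix (Fin (m + 1)) (Fin (m + 1)) ℂ} (h00 : A 0 0 = B 0 0)
    (h0 : ∀ j : Fin m, A 0 j.succ = B 0 j.succ) (h1 : ∀ i : Fin m, A i.succ 0 = B i.succ 0)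
    (h : ∀ i j : Fin m, A i.succ j.succ = B i.succ j.succ) : A = B := by
  ext i j
  refine Fin.cases ?_ (fun i => ?_) i <;> refine Fin.cases ?_ (fun j => ?_) j
  · exact h00
  · exact h0 j
  · exact h1 i
  · exact h i j

theorem Matrix.IsHermitian.eq_border {m : ℕ} {A : Matrix (Fin (m + 1)) (Fin (m + 1)) ℂ}
    (hA : A.IsHermitian) :
    A = border (A 0 0) (fun i => A i.succ 0) (A.submatrix Fin.succ Fin.succ) :=
  Matrix.ext_succ rfl (fun j => by simpa using (hA.apply 0 j.succ).symm) (fun _ => rfl)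
    fun _ _ => rfl

theorem border_isHermitian {m : ℕ} {a : ℂ} (ha : star a = a) (w : Fin m → ℂ)
    {A : Matrix (Fin m) (Fin m) ℂ} (hA : A.IsHermitian) : (border a w A).IsHermitian :=
  Matrix.ext_succ (by simpa using ha) (fun j => by simp) (fun i => by simp)
    fun i j => by simpa using hA.apply i j

theorem border_sub {m : ℕ} (a a' : ℂ) (w w' : Fin m → ℂ) (A A' : Matrix (Fin m) (Fin m) ℂ) :
    border a w A - border a' w' A' = border (a - a') (w - w') (A - A') :=
  Matrix.ext_succ (by simp) (by simp) (by simp) (by simp)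

theorem continuous_border {X : Type*} [TopologicalSpace X] {m : ℕ} {a : X → ℂ} {w : X → Fin m → ℂ}
    {A : X → Matrix (Fin m) (Fin m) ℂ} (ha : Continuous a) (hw : Continuous w)
    (hA : Continuous A) : Continuous fun x => border (a x) (w x) (A x) := by
  refine continuous_matrix fun i j => ?_
  refine Fin.cases ?_ (fun i => ?_) i <;> refine Fin.cases ?_ (fun j => ?_) j
  · simpa using ha
  · exact continuous_star.comp (continuous_pi_iff.1 hw j)
  · simpa using continuous_pi_iff.1 hw i
  · simpa using hA.matrix_elem i j

theorem border_one_zero_conjTranspose {m : ℕ} (U : Matrix (Fin m) (Fin m) ℂ) :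
    (border 1 0 U)ᴴ = border 1 0 Uᴴ :=
  Matrix.ext_succ (by simp) (by simp) (by simp) (by simp)

/-- Drives the induction: conjugation by `1 ⊕ U` keeps the corner and acts separately on the first
column and the remaining block. -/
theorem border_one_zero_conj {m : ℕ} (U : Matrix (Fin m) (Fin m) ℂ) (a : ℂ) (w : Fin m → ℂ)
    (A : Matrix (Fin m) (Fin m) ℂ) :
    border 1 0 U * border a w A * (border 1 0 U)ᴴ = border a (U *ᵥ w) (U * A * Uᴴ) := by
  rw [border_one_zero_conjTranspose]
  refine Matrix.ext_succ ?_ (fun j => ?_) (fun i => ?_) fun i j => ?_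
  · simp [Matrix.mul_apply, Fin.sum_univ_succ]
  · simp [Matrix.mul_apply, Fin.sum_univ_succ, Matrix.mulVec, dotProduct, mul_comm]
  · simp [Matrix.mul_apply, Fin.sum_univ_succ, Matrix.mulVec, dotProduct]
  · simp [Matrix.mul_apply, Fin.sum_univ_succ]

theorem border_one_zero_mem_unitaryGroup {m : ℕ} {U : Matrix (Fin m) (Fin m) ℂ}
    (hU : U ∈ Matrix.unitaryGroup (Fin m) ℂ) :
    border 1 0 U ∈ Matrix.unitaryGroup (Fin (m + 1)) ℂ := by
  rw [Matrix.mem_unitaryGroup_iff, Matrix.star_eq_conjTranspose] at *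
  have h1 : ∀ l : ℕ, (1 : Matrix (Fin (l + 1)) (Fin (l + 1)) ℂ) = border 1 0 1 := fun l =>
    Matrix.ext_succ (by simp) (fun j => by simp [(Fin.succ_ne_zero j).symm])
      (fun i => by simp)
      (fun i j => by simp [Matrix.one_apply])
  have h := border_one_zero_conj U 1 0 1
  rwa [← h1, Matrix.mul_one, Matrix.mulVec_zero, Matrix.mul_one, hU, ← h1] at h

theorem frobNorm_nonneg {n : ℕ} (A : Matrix (Fin n) (Fin n) ℂ) : 0 ≤ frobNorm A :=
  Real.sqrt_nonneg _

theorem frobNorm_sq {n : ℕ} (A : Matrix (Fin n) (Fin n) ℂ) :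
    frobNorm A ^ 2 = ∑ i, ∑ j, ‖A i j‖ ^ 2 :=
  Real.sq_sqrt (by positivity)

theorem frobNorm_border_zero_sq {m : ℕ} (w : Fin m → ℂ) (A : Matrix (Fin m) (Fin m) ℂ) :
    frobNorm (border 0 w A) ^ 2 = 2 * ∑ i, ‖w i‖ ^ 2 + frobNorm A ^ 2 := by
  rw [frobNorm_sq, frobNorm_sq]
  simp [Fin.sum_univ_succ, Finset.sum_add_distrib]
  ring

/-- On a normal space of covering dimension at most `2 c'`, a field of Hermitian matrices of size
`k + c' + 1` is, up to a unitary and a small perturbation, tridiagonal in its first `k` rows and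
columns, with positive entries below the diagonal. -/
theorem HasCoveringDimLE.exists_tridiagonal {X : Type*} [TopologicalSpace X] [NormalSpace X]
    {d : ℕ} (hX : HasCoveringDimLE X d) {c' : ℕ} (hd : d ≤ 2 * c') (k : ℕ) :
    ∀ {N : ℕ} (_ : N = k + c') (f : C(X, Matrix (Fin (N + 1)) (Fin (N + 1)) ℂ))
      (_ : ∀ x, (f x).IsHermitian) {δ : ℝ} (_ : 0 < δ),
    ∃ (u : C(X, Matrix.unitaryGroup (Fin (N + 1)) ℂ))
      (h : C(X, Matrix (Fin (N + 1)) (Fin (N + 1)) ℂ)),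
      (∀ x, (u x : Matrix (Fin (N + 1)) (Fin (N + 1)) ℂ) *ᵥ Pi.single 0 1 = Pi.single 0 1) ∧
      (∀ x, (h x).IsHermitian) ∧
      (∀ x, frobNorm ((u x : Matrix (Fin (N + 1)) (Fin (N + 1)) ℂ) * f x *
        (u x : Matrix (Fin (N + 1)) (Fin (N + 1)) ℂ)ᴴ - h x) < δ) ∧
      ∀ x (i j : Fin (N + 1)), (i : ℕ) < k →
        ((j : ℕ) = i + 1 → 0 < h x j i) ∧ ((i : ℕ) + 1 < j → h x j i = 0) := by
  induction k with
  | zero =>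
    intro N _ f hf δ hδ
    exact ⟨ContinuousMap.const X 1, f, fun x => Matrix.one_mulVec _, hf, fun x => by simpa [frobNorm] using hδ,
      fun x i j hi => absurd hi (Nat.not_lt_zero _)⟩
  | succ k ih =>
    intro N hN f hf δ hδ
    obtain ⟨N, rfl⟩ : ∃ M, N = M + 1 := ⟨k + c', by omega⟩
    -- Now `N = k + c' ≥ c'`, so `d ≤ 2N`. With this `η`, the `N + 1` column errors have square sum
    -- at most `δ² / 4`; it counts twice, and the block adds less than `(δ / 2)²`, so the total
    -- stays below `δ²`.
    obtain ⟨s, V, b', hs, hbb, hVb⟩ := hX.exists_unitary_mulVec_eq (N := N) (by omega)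
      (⟨fun x i => f x i.succ 0, continuous_pi fun i => f.continuous.matrix_elem _ _⟩)
      (η := δ / (2 * (N + 1 : ℝ))) (by positivity)
    -- The unitary `u'` fixes the first basis vector, so it preserves the column `s e₀` produced by
    -- `V`. This is why the induction carries that condition.
    obtain ⟨u', h', hu0, hh, hfr, htri⟩ := ih (N := N) (by omega)
      ⟨fun x => (V x : Matrix (Fin (N + 1)) (Fin (N + 1)) ℂ) * (f x).submatrix Fin.succ Fin.succ *
          (V x : Matrix (Fin (N + 1)) (Fin (N + 1)) ℂ)ᴴ, by
        have hV : Continuous fun x => (V x : Matrix (Fin (N + 1)) (Fin (N + 1)) ℂ) :=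
          continuous_subtype_val.comp V.continuous
        have hF := f.continuous.matrix_submatrix (Fin.succ : Fin (N + 1) → _) Fin.succ
        exact (hV.mul hF).mul hV.matrix_conjTranspose⟩
      (fun x => Matrix.isHermitian_mul_mul_conjTranspose _ ((hf x).submatrix _))
      (half_pos hδ)
    refine ⟨⟨fun x => ⟨border 1 0 (u' x * V x : Matrix.unitaryGroup (Fin (N + 1)) ℂ),
        border_one_zero_mem_unitaryGroup (u' x * V x).2⟩, ?_⟩,
      ⟨fun x => border (f x 0 0) (Pi.single 0 (s x : ℂ)) (h' x), ?_⟩, fun x => ?_, fun x => ?_,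
      fun x => ?_, fun x i j hi => ?_⟩
    · exact (continuous_border continuous_const continuous_const
        (continuous_subtype_val.comp (u'.continuous.mul V.continuous))).subtype_mk _
    · refine continuous_border (f.continuous.matrix_elem _ _) ?_ h'.continuous
      exact (continuous_single (A := fun _ : Fin (N + 1) => ℂ) 0).comp
        (Complex.continuous_ofReal.comp s.continuous)
    · ext i
      refine Fin.cases ?_ (fun i => ?_) i <;> simp
    · exact border_isHermitian ((hf x).apply 0 0) _ (hh x)
    · have hu := hfr x
      simp only [ContinuousMap.coe_mk] at hu ⊢
      rw [(hf x).eq_border, border_one_zero_conj, ← (hf x).eq_border, border_sub, sub_self]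
      refine lt_of_pow_lt_pow_left₀ 2 hδ.le ?_
      rw [frobNorm_border_zero_sq]
      set w : Fin (N + 1) → ℂ := fun i => f x i.succ 0 with hw
      have h1 : ((u' x * V x : Matrix.unitaryGroup (Fin (N + 1)) ℂ) :
            Matrix (Fin (N + 1)) (Fin (N + 1)) ℂ) *ᵥ w -
            Pi.single 0 (s x : ℂ) =
          ((u' x * V x : Matrix.unitaryGroup (Fin (N + 1)) ℂ) :
            Matrix (Fin (N + 1)) (Fin (N + 1)) ℂ) *ᵥ (w - b' x) := by
        have h2 : Pi.single 0 (s x : ℂ) = (s x : ℂ) • (Pi.single 0 1 : Fin (N + 1) → ℂ) := by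
          rw [← Pi.single_smul, smul_eq_mul, mul_one]
        rw [Matrix.mulVec_sub, Submonoid.coe_mul, ← Matrix.mulVec_mulVec (b' x), hVb, h2,
          Matrix.mulVec_smul, hu0]
      rw [h1, sum_norm_sq_unitary_mulVec (u' x * V x).2, Submonoid.coe_mul,
        Matrix.conjTranspose_mul]
      simp only [Matrix.mul_assoc] at hu ⊢
      have h3 : ∑ i, ‖(w - b' x) i‖ ^ 2 ≤
          ∑ _i : Fin (N + 1), (δ / (2 * (N + 1 : ℝ))) ^ 2 :=
        Finset.sum_le_sum fun i _ =>
          pow_le_pow_left₀ (norm_nonneg _) (hbb x i).le 2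
      have h4 : ∑ _i : Fin (N + 1), (δ / (2 * (N + 1 : ℝ))) ^ 2 ≤ δ ^ 2 / 4 := by
        rw [Finset.sum_const, Finset.card_univ, Fintype.card_fin, nsmul_eq_mul]
        push_cast
        rw [show ((N : ℝ) + 1) * (δ / (2 * ((N : ℝ) + 1))) ^ 2 = δ ^ 2 / 4 / ((N : ℝ) + 1) by
          field_simp; ring]
        exact div_le_self (by positivity) (by linarith [N.cast_nonneg (α := ℝ)])
      have h5 := pow_lt_pow_left₀ hu (frobNorm_nonneg _) two_ne_zero
      nlinarith
    · simp only [ContinuousMap.coe_mk]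
      revert hi
      refine Fin.cases (fun _ => ?_) (fun i hi => ?_) i <;>
        refine Fin.cases ?_ (fun j => ?_) j
      · simp
      · refine ⟨fun hj => ?_, fun hj => ?_⟩
        · have : j = 0 := by
            ext
            simpa using hj
          subst this
          rw [border_succ_zero, Pi.single_eq_same]
          exact_mod_cast hs x
        · have : j ≠ 0 := by
            rintro rfl
            simp at hj
          simp [this]
      · simp
      · have := htri x i j (by simpa using hi)
        simpa using this

/-! ### Jacobi matrices: simplicity of the spectrum and uniqueness of eigenprojections -/

/-- `A` is tridiagonal below the diagonal, with nonzero entries immediately below it. -/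
def IsJacobi {k : ℕ} (A : Matrix (Fin k) (Fin k) ℂ) : Prop :=
  ∀ i j : Fin k, ((j : ℕ) = i + 1 → A j i ≠ 0) ∧ ((i : ℕ) + 1 < j → A j i = 0)

/-- Three-term recurrence: row `m` of the eigenvalue equation determines `v (m + 1)` from the
earlier entries, because its coefficient is nonzero. -/
theorem IsJacobi.eq_zero_of_mulVec_eq_smul {k : ℕ} {A : Matrix (Fin (k + 1)) (Fin (k + 1)) ℂ}
    (hA : A.IsHermitian) (hJ : IsJacobi A) {μ : ℂ} {v : Fin (k + 1) → ℂ} (hv : A *ᵥ v = μ • v)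
    (h0 : v 0 = 0) : v = 0 := by
  have key : ∀ m (hm : m < k + 1), v ⟨m, hm⟩ = 0 := by
    intro m
    induction m using Nat.strong_induction_on with
    | _ m ih =>
      intro hm
      rcases m with _ | m
      · exact h0
      · have hrow := congrFun hv ⟨m, by omega⟩
        rw [Pi.smul_apply, ih m (by omega), smul_zero, Matrix.mulVec, dotProduct,
          Finset.sum_eq_single ⟨m + 1, hm⟩] at hrow
        · refine (mul_eq_zero.1 hrow).resolve_left fun h => ?_
          refine (hJ ⟨m, by omega⟩ ⟨m + 1, hm⟩).1 rfl ?_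
          rw [← hA.apply, h, star_zero]
        · intro l _ hl
          rcases lt_or_gt_of_ne (fun h => hl (Fin.ext h) : (l : ℕ) ≠ m + 1) with h | h
          · rw [ih l h l.2, mul_zero]
          · rw [← hA.apply, (hJ ⟨m, by omega⟩ l).2 h, star_zero, zero_mul]
        · simp
  exact funext fun i => key i i.2

/-- Subtracting from `w` the multiple of `v` with the same first entry leaves an eigenvector
equation with zero initial value. -/
theorem IsJacobi.exists_eq_smul {k : ℕ} {A : Matrix (Fin k) (Fin k) ℂ}
    (hA : A.IsHermitian) (hJ : IsJacobi A) {μ : ℂ} {v w : Fin k → ℂ} (hv : A *ᵥ v = μ • v)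
    (hw : A *ᵥ w = μ • w) (h0 : v ≠ 0) : ∃ c : ℂ, w = c • v := by
  rcases k with _ | k
  · exact ⟨0, Subsingleton.elim _ _⟩
  have hv0 : v 0 ≠ 0 := fun h => h0 (hJ.eq_zero_of_mulVec_eq_smul hA hv h)
  refine ⟨w 0 / v 0, sub_eq_zero.1 (hJ.eq_zero_of_mulVec_eq_smul hA (μ := μ) ?_ ?_)⟩
  · rw [Matrix.mulVec_sub, Matrix.mulVec_smul, hv, hw, smul_sub, smul_comm]
  · simp [hv0]

/-- An orthonormal basis of eigenvectors of `A`, ordered by decreasing eigenvalues. -/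
structure IsEigenSystem {k : ℕ} (A : Matrix (Fin k) (Fin k) ℂ) (μ : Fin k → ℝ)
    (w : Fin k → Fin k → ℂ) : Prop where
  antitone : Antitone μ
  orthonormal : ∀ i j, star (w i) ⬝ᵥ w j = if i = j then 1 else 0
  mulVec_eq : ∀ i, A *ᵥ w i = (μ i : ℂ) • w i

theorem Matrix.IsHermitian.exists_isEigenSystem {k : ℕ} {A : Matrix (Fin k) (Fin k) ℂ}
    (hA : A.IsHermitian) : ∃ μ w, IsEigenSystem A μ w := by
  -- `eigenvalues` is the decreasing list `eigenvalues₀` reindexed through this equivalence;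
  -- composing with `σ` undoes the reindexing.
  let e : Fin (Fintype.card (Fin k)) ≃ Fin k := Fintype.equivOfCardEq (Fintype.card_fin _)
  let σ : Fin k ≃ Fin k := (finCongr (Fintype.card_fin k).symm).trans e
  refine ⟨fun i => hA.eigenvalues (σ i), fun i => ⇑(hA.eigenvectorBasis (σ i)), ?_, ?_, ?_⟩
  · intro i j hij
    have : ∀ i, hA.eigenvalues (σ i) = hA.eigenvalues₀ (finCongr (Fintype.card_fin k).symm i) :=
      fun i => congrArg hA.eigenvalues₀ (e.symm_apply_apply _)
    simp only [this]
    exact hA.eigenvalues₀_antitone hij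
  · intro i j
    have := orthonormal_iff_ite.1 hA.eigenvectorBasis.orthonormal (σ i) (σ j)
    rw [EuclideanSpace.inner_eq_star_dotProduct, dotProduct_comm] at this
    simpa using this
  · intro i
    exact hA.mulVec_eigenvectorBasis (σ i)

namespace IsEigenSystem

variable {k : ℕ} {A : Matrix (Fin k) (Fin k) ℂ} {μ ν : Fin k → ℝ} {v w : Fin k → Fin k → ℂ}

theorem ne_zero (h : IsEigenSystem A μ w) (i : Fin k) : w i ≠ 0 := by
  intro h0
  simpa [h0] using h.orthonormal i i

theorem eq_dotProduct (h : IsEigenSystem A μ w) (i : Fin k) :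
    μ i = (star (w i) ⬝ᵥ A *ᵥ w i).re := by
  rw [h.mulVec_eq, dotProduct_smul, h.orthonormal, if_pos rfl]
  simp

theorem norm_le (h : IsEigenSystem A μ w) (i j : Fin k) : ‖w i j‖ ≤ 1 := by
  have h1 := h.orthonormal i i
  rw [if_pos rfl, star_dotProduct_self_eq] at h1
  have h2 : ∑ j, ‖w i j‖ ^ 2 = 1 := by exact_mod_cast h1
  have h3 := Finset.single_le_sum (f := fun j => ‖w i j‖ ^ 2) (fun j _ => by positivity)
    (Finset.mem_univ j)
  rw [h2] at h3
  exact (sq_le_one_iff₀ (norm_nonneg _)).1 h3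

theorem strictAnti (h : IsEigenSystem A μ w) (hA : A.IsHermitian) (hJ : IsJacobi A) :
    StrictAnti μ := by
  refine h.antitone.strictAnti_of_injective fun i j hij => ?_
  by_contra hne
  obtain ⟨c, hc⟩ := hJ.exists_eq_smul hA (h.mulVec_eq i) (hij ▸ h.mulVec_eq j) (h.ne_zero i)
  have h1 := h.orthonormal i j
  rw [hc, dotProduct_smul, h.orthonormal, if_pos rfl, if_neg hne, smul_eq_mul, mul_one] at h1
  exact h.ne_zero j (by rw [hc, h1, zero_smul])

theorem sum_vecMulVec (h : IsEigenSystem A μ w) :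
    ∑ i, Matrix.vecMulVec (w i) (star (w i)) = 1 := by
  let W : Matrix (Fin k) (Fin k) ℂ := Matrix.of fun i j => w j i
  have hW : Wᴴ * W = 1 := by
    ext i j
    rw [Matrix.one_apply, ← h.orthonormal i j]
    rfl
  rw [mul_eq_one_comm] at hW
  rw [← hW]
  ext i j
  simp [Matrix.sum_apply, Matrix.mul_apply, Matrix.vecMulVec_apply, W]

theorem eq_sum (h : IsEigenSystem A μ w) :
    A = ∑ i, μ i • Matrix.vecMulVec (w i) (star (w i)) := by
  conv_lhs => rw [← Matrix.mul_one A, ← h.sum_vecMulVec, Finset.mul_sum]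
  refine Finset.sum_congr rfl fun i _ => ?_
  rw [Matrix.mul_vecMulVec, h.mulVec_eq, Matrix.smul_vecMulVec]
  rfl

/-- Eigenvectors of a Hermitian matrix for distinct eigenvalues are orthogonal, so a value of `ν`
missed by `μ` would have an eigenvector orthogonal to a whole basis. -/
theorem range_subset (h : IsEigenSystem A μ w) (h' : IsEigenSystem A ν v) :
    Set.range ν ⊆ Set.range μ := by
  rintro _ ⟨i, rfl⟩
  by_contra hne
  refine h'.ne_zero i ?_
  have hA : A.IsHermitian := by
    rw [h.eq_sum]
    rw [Matrix.IsHermitian, Matrix.conjTranspose_sum]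
    refine Finset.sum_congr rfl fun i _ => ?_
    rw [Matrix.conjTranspose_smul, Matrix.conjTranspose_vecMulVec, star_star,
      star_trivial]
  have hc : ∀ j, star (w j) ⬝ᵥ v i = 0 := by
    intro j
    have h1 : star (w j) ⬝ᵥ A *ᵥ v i = (ν i : ℂ) * (star (w j) ⬝ᵥ v i) := by
      rw [h'.mulVec_eq, dotProduct_smul, smul_eq_mul]
    have h2 : star (w j) ⬝ᵥ A *ᵥ v i = (μ j : ℂ) * (star (w j) ⬝ᵥ v i) := by
      rw [Matrix.dotProduct_mulVec]
      nth_rewrite 1 [← hA.eq]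
      rw [← Matrix.star_mulVec, h.mulVec_eq, star_smul, smul_dotProduct, smul_eq_mul]
      simp
    rw [h1] at h2
    refine (mul_eq_mul_right_iff.1 h2).resolve_left fun h3 => hne ⟨j, ?_⟩
    exact_mod_cast h3.symm
  rw [← Matrix.one_mulVec (v i), ← h.sum_vecMulVec, Matrix.sum_mulVec]
  refine Finset.sum_eq_zero fun j _ => ?_
  rw [Matrix.vecMulVec_mulVec, hc, MulOpposite.op_zero, zero_smul]

/-- Both lists enumerate the same set in strictly decreasing order. The eigenvectors then differ by
a phase, which cancels in the projections. -/
theorem unique (h : IsEigenSystem A μ w) (h' : IsEigenSystem A ν v) (hA : A.IsHermitian)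
    (hJ : IsJacobi A) :
    ν = μ ∧ ∀ i, Matrix.vecMulVec (v i) (star (v i)) = Matrix.vecMulVec (w i) (star (w i)) := by
  have hνμ : ν = μ := by
    have := (StrictMono.range_inj (h'.strictAnti hA hJ).dual_right
      (h.strictAnti hA hJ).dual_right).1 (by
        rw [Set.range_comp, Set.range_comp,
          (h'.range_subset h).antisymm (h.range_subset h')])
    exact this
  subst hνμ
  refine ⟨rfl, fun i => ?_⟩
  obtain ⟨c, hc⟩ := hJ.exists_eq_smul hA (h.mulVec_eq i) (h'.mulVec_eq i) (h.ne_zero i)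
  have h1 := h'.orthonormal i i
  rw [hc, star_smul, smul_dotProduct, dotProduct_smul, h.orthonormal, if_pos rfl, smul_eq_mul,
    smul_eq_mul, mul_one] at h1
  rw [hc, star_smul, Matrix.smul_vecMulVec, Matrix.vecMulVec_smul, smul_smul, mul_comm, h1,
    one_smul]

theorem nonneg (h : IsEigenSystem A μ w) (hA : A.PosSemidef) (i : Fin k) : 0 ≤ μ i := by
  rw [h.eq_dotProduct]
  exact (Complex.nonneg_iff.1 (hA.dotProduct_mulVec_nonneg _)).1

end IsEigenSystem

/-! ### Continuity of eigenvalues and eigenprojections -/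

open Filter Topology in
theorem tendsto_star_dotProduct {X : Type*} {l : Filter X} {m : ℕ} {v w : X → Fin m → ℂ}
    {a b : Fin m → ℂ} (hv : Tendsto v l (𝓝 a)) (hw : Tendsto w l (𝓝 b)) :
    Tendsto (fun x => star (v x) ⬝ᵥ w x) l (𝓝 (star a ⬝ᵥ b)) :=
  tendsto_finsetSum _ fun i _ =>
    ((continuous_star.tendsto _).comp (tendsto_pi_nhds.1 hv i)).mul (tendsto_pi_nhds.1 hw i)

open Filter Topology in
/-- The eigenvalues and the eigenprojections of a continuous field of Hermitian Jacobi matrices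
are continuous. -/
theorem continuous_eigenSystem {X : Type*} [TopologicalSpace X] {k : ℕ}
    {J : X → Matrix (Fin k) (Fin k) ℂ} (hJc : Continuous J) (hJh : ∀ x, (J x).IsHermitian)
    (hJ : ∀ x, IsJacobi (J x)) {μ : X → Fin k → ℝ} {w : X → Fin k → Fin k → ℂ}
    (h : ∀ x, IsEigenSystem (J x) (μ x) (w x)) (i : Fin k) :
    Continuous (fun x => μ x i) ∧
      Continuous fun x => Matrix.vecMulVec (w x i) (star (w x i)) := by
  -- The eigenvectors `w x` are arbitrary choices, with no continuity. Being bounded, they converge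
  -- along an ultrafilter; the limit is an eigensystem of `J x₀`, and uniqueness identifies its
  -- eigenvalues and projections.
  have key : ∀ (x₀ : X) (𝒰 : Ultrafilter X), (𝒰 : Filter X) ≤ 𝓝 x₀ →
      Tendsto (fun x => μ x i) 𝒰 (𝓝 (μ x₀ i)) ∧
      Tendsto (fun x => Matrix.vecMulVec (w x i) (star (w x i))) 𝒰
        (𝓝 (Matrix.vecMulVec (w x₀ i) (star (w x₀ i)))) := by
    intro x₀ 𝒰 h𝒰
    have hball : ∀ x, w x ∈ Metric.closedBall (0 : Fin k → Fin k → ℂ) 1 := fun x => by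
      rw [mem_closedBall_zero_iff, pi_norm_le_iff_of_nonneg zero_le_one]
      intro i
      rw [pi_norm_le_iff_of_nonneg zero_le_one]
      exact (h x).norm_le i
    obtain ⟨v, -, hv⟩ := (isCompact_closedBall (0 : Fin k → Fin k → ℂ) 1).ultrafilter_le_nhds
      (𝒰.map w) (by
        rw [Ultrafilter.coe_map, le_principal_iff]
        exact mem_map.2 (univ_mem' hball))
    have hvi : ∀ i, Tendsto (fun x => w x i) 𝒰 (𝓝 (v i)) := fun i => tendsto_pi_nhds.1 hv i
    have hJt : Tendsto J 𝒰 (𝓝 (J x₀)) := (hJc.tendsto x₀).mono_left h𝒰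
    have hdot : ∀ i j, Tendsto (fun x => star (w x i) ⬝ᵥ w x j) 𝒰 (𝓝 (star (v i) ⬝ᵥ v j)) :=
      fun i j => tendsto_star_dotProduct (hvi i) (hvi j)
    have hmul : ∀ i, Tendsto (fun x => J x *ᵥ w x i) 𝒰 (𝓝 (J x₀ *ᵥ v i)) := by
      intro i
      refine tendsto_pi_nhds.2 fun a => ?_
      simp only [Matrix.mulVec, dotProduct]
      refine tendsto_finsetSum _ fun b _ => ?_
      exact (tendsto_pi_nhds.1 (tendsto_pi_nhds.1 hJt a) b).mul (tendsto_pi_nhds.1 (hvi i) b)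
    have hμ : ∀ i, Tendsto (fun x => μ x i) 𝒰 (𝓝 (star (v i) ⬝ᵥ J x₀ *ᵥ v i).re) := by
      intro i
      exact ((Complex.continuous_re.tendsto _).comp
        (tendsto_star_dotProduct (hvi i) (hmul i))).congr fun x => ((h x).eq_dotProduct i).symm
    have hlim : IsEigenSystem (J x₀) (fun i => (star (v i) ⬝ᵥ J x₀ *ᵥ v i).re) v := by
      refine ⟨fun i j hij => le_of_tendsto_of_tendsto' (hμ j) (hμ i) fun x => (h x).antitone hij,
        fun i j => ?_, fun i => ?_⟩
      · refine tendsto_nhds_unique (hdot i j) (tendsto_const_nhds.congr fun x => ?_)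
        exact ((h x).orthonormal i j).symm
      · refine tendsto_nhds_unique ((hmul i).congr fun x => (h x).mulVec_eq i) ?_
        exact ((Complex.continuous_ofReal.tendsto _).comp (hμ i)).smul (hvi i)
    obtain ⟨h1, h2⟩ := (h x₀).unique hlim (hJh x₀) (hJ x₀)
    refine ⟨?_, ?_⟩
    · rw [← h1]
      exact hμ i
    · rw [← h2 i]
      have hc : Continuous fun p : Fin k → ℂ => Matrix.vecMulVec p (star p) :=
        continuous_id.matrix_vecMulVec continuous_star
      exact (hc.tendsto (v i)).comp (hvi i)
  exact ⟨continuous_iff_ultrafilter.2 fun x 𝒰 h𝒰 => (key x 𝒰 h𝒰).1,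
    continuous_iff_ultrafilter.2 fun x 𝒰 h𝒰 => (key x 𝒰 h𝒰).2⟩

/-! ### Frobenius and operator norms -/

section norms

variable {n : ℕ}

theorem frobNorm_eq_norm (A : Matrix (Fin n) (Fin n) ℂ) :
    frobNorm A = ‖WithLp.toLp 2 (fun p : Fin n × Fin n => A p.1 p.2)‖ := by
  rw [EuclideanSpace.norm_eq, Fintype.sum_prod_type]
  rfl

theorem frobNorm_add_le (A B : Matrix (Fin n) (Fin n) ℂ) :
    frobNorm (A + B) ≤ frobNorm A + frobNorm B := by
  simp only [frobNorm_eq_norm]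
  exact norm_add_le (WithLp.toLp 2 (fun p : Fin n × Fin n => A p.1 p.2))
    (WithLp.toLp 2 (fun p : Fin n × Fin n => B p.1 p.2))

theorem frobNorm_neg (A : Matrix (Fin n) (Fin n) ℂ) : frobNorm (-A) = frobNorm A := by
  simp [frobNorm]

theorem frobNorm_smul (r : ℝ) (A : Matrix (Fin n) (Fin n) ℂ) :
    frobNorm (r • A) = |r| * frobNorm A := by
  simp only [frobNorm_eq_norm]
  rw [← Real.norm_eq_abs, ← norm_smul]
  rfl

theorem frobNorm_one_le : frobNorm (1 : Matrix (Fin n) (Fin n) ℂ) ≤ n := by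
  refine Real.sqrt_le_iff.2 ⟨n.cast_nonneg, ?_⟩
  have : ∀ i : Fin n, ∑ j, ‖(1 : Matrix (Fin n) (Fin n) ℂ) i j‖ ^ 2 = 1 := fun i => by
    rw [Finset.sum_eq_single i] <;> simp +contextual [eq_comm]
  simp only [this, Finset.sum_const, Finset.card_univ, Fintype.card_fin, nsmul_eq_mul, mul_one]
  rw [sq]
  exact_mod_cast Nat.le_mul_self n

theorem frobNorm_sq_eq_trace (A : Matrix (Fin n) (Fin n) ℂ) :
    ((frobNorm A ^ 2 : ℝ) : ℂ) = (Aᴴ * A).trace := by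
  rw [frobNorm_sq, Finset.sum_comm]
  simp [Matrix.trace, Matrix.mul_apply, Complex.conj_mul']

theorem frobNorm_unitary_conj {U : Matrix (Fin n) (Fin n) ℂ}
    (hU : U ∈ Matrix.unitaryGroup (Fin n) ℂ) (A : Matrix (Fin n) (Fin n) ℂ) :
    frobNorm (U * A * Uᴴ) = frobNorm A := by
  rw [← pow_left_inj₀ (frobNorm_nonneg _) (frobNorm_nonneg _) two_ne_zero]
  have hU' : Uᴴ * U = 1 := Matrix.mem_unitaryGroup_iff'.1 hU
  have h : ((frobNorm (U * A * Uᴴ) ^ 2 : ℝ) : ℂ) = ((frobNorm A ^ 2 : ℝ) : ℂ) := by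
    rw [frobNorm_sq_eq_trace, frobNorm_sq_eq_trace, Matrix.conjTranspose_mul,
      Matrix.conjTranspose_mul, Matrix.conjTranspose_conjTranspose]
    have : U * (Aᴴ * Uᴴ) * (U * A * Uᴴ) = U * (Aᴴ * A * Uᴴ) := by
      calc _ = U * Aᴴ * (Uᴴ * U) * A * Uᴴ := by simp only [Matrix.mul_assoc]
        _ = _ := by rw [hU', Matrix.mul_one]; simp only [Matrix.mul_assoc]
    rw [this, Matrix.trace_mul_comm, Matrix.mul_assoc, hU', Matrix.mul_one]
  exact_mod_cast h

theorem opNorm_le_frobNorm (A : Matrix (Fin n) (Fin n) ℂ) : opNorm A ≤ frobNorm A := by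
  refine ContinuousLinearMap.opNorm_le_bound _ (frobNorm_nonneg A) fun v => ?_
  refine le_of_sq_le_sq ?_ (mul_nonneg (frobNorm_nonneg A) (norm_nonneg v))
  rw [mul_pow, frobNorm_sq, EuclideanSpace.norm_sq_eq, EuclideanSpace.norm_sq_eq, Finset.sum_mul]
  refine Finset.sum_le_sum fun i _ => ?_
  rw [Matrix.ofLp_toEuclideanCLM]
  calc ‖∑ j, A i j * v.ofLp j‖ ^ 2 ≤ (∑ j, ‖A i j‖ * ‖v.ofLp j‖) ^ 2 := by
        gcongr
        exact (norm_sum_le _ _).trans_eq (Finset.sum_congr rfl fun j _ => norm_mul _ _)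
    _ ≤ _ := Finset.sum_mul_sq_le_sq_mul_sq _ _ _

theorem norm_apply_le_opNorm (A : Matrix (Fin n) (Fin n) ℂ) (i j : Fin n) :
    ‖A i j‖ ≤ opNorm A := by
  have h := (Matrix.toEuclideanCLM (n := Fin n) (𝕜 := ℂ) A).le_opNorm (EuclideanSpace.single j 1)
  rw [PiLp.norm_single, norm_one, mul_one] at h
  refine le_trans ?_ h
  refine le_trans (le_of_eq ?_) (PiLp.norm_apply_le _ i)
  rw [Matrix.ofLp_toEuclideanCLM]
  simp

open scoped Matrix.Norms.L2Operator in
theorem opNorm_unitary_conj {U : Matrix (Fin n) (Fin n) ℂ}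
    (hU : U ∈ Matrix.unitaryGroup (Fin n) ℂ) (A : Matrix (Fin n) (Fin n) ℂ) :
    opNorm (U * A * Uᴴ) = opNorm A := by
  change ‖U * A * Uᴴ‖ = ‖A‖
  rw [← Matrix.star_eq_conjTranspose, CStarRing.norm_mul_mem_unitary _ (Unitary.star_mem hU),
    CStarRing.norm_mem_unitary_mul _ hU]

open scoped Matrix.Norms.L2Operator in
theorem opNorm_diagonal (v : Fin n → ℂ) : opNorm (Matrix.diagonal v) = ‖v‖ :=
  Matrix.l2_opNorm_diagonal v

theorem opNorm_add_le (A B : Matrix (Fin n) (Fin n) ℂ) :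
    opNorm (A + B) ≤ opNorm A + opNorm B := by
  unfold opNorm
  rw [map_add]
  exact norm_add_le _ _

theorem opNorm_neg (A : Matrix (Fin n) (Fin n) ℂ) : opNorm (-A) = opNorm A := by
  unfold opNorm
  rw [map_neg, norm_neg]

theorem opNorm_smul (r : ℝ) (A : Matrix (Fin n) (Fin n) ℂ) :
    opNorm (r • A) = |r| * opNorm A := by
  unfold opNorm
  rw [← Real.norm_eq_abs, ← Complex.norm_real, ← norm_smul, ← map_smul]
  rfl

/-- A Hermitian matrix of operator norm at most `s` becomes positive after adding `s`. -/
theorem posSemidef_add_smul_one {A : Matrix (Fin n) (Fin n) ℂ} (hA : A.IsHermitian) {s : ℝ}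
    (hs : opNorm A ≤ s) : (A + s • (1 : Matrix (Fin n) (Fin n) ℂ)).PosSemidef := by
  have hs1 : (s • (1 : Matrix (Fin n) (Fin n) ℂ)).IsHermitian := by
    rw [Matrix.IsHermitian, Matrix.conjTranspose_smul, Matrix.conjTranspose_one, star_trivial]
  refine Matrix.PosSemidef.of_dotProduct_mulVec_nonneg (hA.add hs1) fun v => ?_
  rw [Complex.nonneg_iff]
  refine ⟨?_, ?_⟩
  · have h1 : (star v ⬝ᵥ A *ᵥ v).re = (inner ℂ (WithLp.toLp 2 v)
        (Matrix.toEuclideanCLM (n := Fin n) (𝕜 := ℂ) A (WithLp.toLp 2 v))).re := by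
      rw [EuclideanSpace.inner_eq_star_dotProduct, Matrix.ofLp_toEuclideanCLM, dotProduct_comm]
    have h2 := abs_le.1 ((Complex.abs_re_le_norm _).trans (norm_inner_le_norm (𝕜 := ℂ)
      (WithLp.toLp 2 v) (Matrix.toEuclideanCLM (n := Fin n) (𝕜 := ℂ) A (WithLp.toLp 2 v))))
    have h3 := (Matrix.toEuclideanCLM (n := Fin n) (𝕜 := ℂ) A).le_opNorm (WithLp.toLp 2 v)
    have h4 : (star v ⬝ᵥ v).re = ‖WithLp.toLp 2 v‖ ^ 2 := by
      rw [star_dotProduct_self_eq, Complex.ofReal_re, EuclideanSpace.norm_sq_eq]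
    rw [Matrix.add_mulVec, dotProduct_add, Matrix.smul_mulVec, Matrix.one_mulVec,
      dotProduct_smul, Complex.add_re, Complex.smul_re, h4, h1, smul_eq_mul]
    have h5 := norm_nonneg (WithLp.toLp 2 v)
    change ‖_‖ ≤ s at hs
    nlinarith [h2.1, mul_le_mul_of_nonneg_left h3 h5, mul_le_mul_of_nonneg_left hs (mul_nonneg h5 h5)]
  · exact ((hA.add hs1).im_star_dotProduct_mulVec_self v).symm

end norms

/-! ### Functional calculus and constant spectral projections -/

section spectral

variable {n : ℕ} {W : Matrix (Fin n) (Fin n) ℂ}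

/-- The functional calculus of a matrix diagonalized by a unitary matrix. -/
theorem cfc_unitary_conj_diagonal (hW : W ∈ Matrix.unitaryGroup (Fin n) ℂ) (μ : Fin n → ℝ)
    (f : ℝ → ℝ) :
    cfc f (W * Matrix.diagonal (fun i => (μ i : ℂ)) * Wᴴ) =
      W * Matrix.diagonal (fun i => (f (μ i) : ℂ)) * Wᴴ := by
  have hd : ∀ ν : Fin n → ℝ, (Matrix.diagonal fun i => (ν i : ℂ)).IsHermitian := fun ν =>
    Matrix.isHermitian_diagonal_of_self_adjoint _ (by ext i; simp)
  have hA : (W * Matrix.diagonal (fun i => (μ i : ℂ)) * Wᴴ).IsHermitian :=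
    Matrix.isHermitian_mul_mul_conjTranspose _ (hd μ)
  rw [hA.cfc_eq, Matrix.IsHermitian.cfc, Unitary.conjStarAlgAut_apply]
  have hspec := hA.spectral_theorem
  rw [Unitary.conjStarAlgAut_apply] at hspec
  set U : Matrix (Fin n) (Fin n) ℂ := hA.eigenvectorUnitary.1
  have hU : star U * U = 1 := Unitary.coe_star_mul_self _
  have hU' : U * star U = 1 := Unitary.coe_mul_star_self _
  have hW1 : Wᴴ * W = 1 := Matrix.mem_unitaryGroup_iff'.1 hW
  have hW2 : W * Wᴴ = 1 := Matrix.mem_unitaryGroup_iff.1 hW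
  set M := star U * W
  have h1 : Matrix.diagonal (RCLike.ofReal ∘ hA.eigenvalues) * M =
      M * Matrix.diagonal (fun i => (μ i : ℂ)) := by
    calc _ = star U * U * Matrix.diagonal (RCLike.ofReal ∘ hA.eigenvalues) * (star U * W) := by
          rw [hU, Matrix.one_mul]
      _ = star U * (U * Matrix.diagonal (RCLike.ofReal ∘ hA.eigenvalues) * star U) * W := by
          simp only [Matrix.mul_assoc]
      _ = star U * W * Matrix.diagonal (fun i => (μ i : ℂ)) * (Wᴴ * W) := by
          rw [← hspec]
          simp only [Matrix.mul_assoc]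
      _ = _ := by rw [hW1, Matrix.mul_one]
  -- A nonzero entry of the intertwiner `M` forces the two corresponding eigenvalues to agree, hence
  -- also their images under `f`.
  have h2 : Matrix.diagonal (RCLike.ofReal ∘ f ∘ hA.eigenvalues) * M =
      M * Matrix.diagonal (fun i => (f (μ i) : ℂ)) := by
    ext i j
    have h3 := congrFun (congrFun h1 i) j
    rw [Matrix.diagonal_mul, Matrix.mul_diagonal, mul_comm, mul_eq_mul_left_iff] at h3
    rw [Matrix.diagonal_mul, Matrix.mul_diagonal]
    rcases h3 with h3 | h3
    · have h4 : hA.eigenvalues i = μ j := by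
        simpa only [Function.comp_apply, RCLike.ofReal_inj, Complex.coe_algebraMap,
          Complex.ofReal_inj] using! h3
      simp [h4, mul_comm]
    · simp [h3]
  calc _ = U * Matrix.diagonal (RCLike.ofReal ∘ f ∘ hA.eigenvalues) * star U * (W * Wᴴ) := by
        rw [hW2, Matrix.mul_one]
    _ = U * (Matrix.diagonal (RCLike.ofReal ∘ f ∘ hA.eigenvalues) * M) * Wᴴ := by
        simp only [M, Matrix.mul_assoc]
    _ = U * star U * W * Matrix.diagonal (fun i => (f (μ i) : ℂ)) * Wᴴ := by
        rw [h2]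
        simp only [M, Matrix.mul_assoc]
    _ = _ := by rw [hU', Matrix.one_mul]

theorem isTrivialProjField_const {X : Type*} [TopologicalSpace X]
    (hW : W ∈ Matrix.unitaryGroup (Fin n) ℂ) (T : Set (Fin n)) :
    IsTrivialProjField fun _ : X =>
      W * Matrix.diagonal (fun i => ((T.indicator (fun _ => (1 : ℝ)) i : ℝ) : ℂ)) * Wᴴ := by
  classical
  let e := (Fintype.equivFin T).symm
  have hW1 : Wᴴ * W = 1 := Matrix.mem_unitaryGroup_iff'.1 hW
  refine ⟨Fintype.card T, ContinuousMap.const X (W.submatrix id fun i => (e i : Fin n)),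
    fun _ => ⟨?_, ?_⟩⟩
  · rw [ContinuousMap.const_apply, Matrix.conjTranspose_submatrix,
      ← Matrix.submatrix_mul _ _ _ id _ Function.bijective_id, hW1]
    exact Matrix.submatrix_one _ (Subtype.val_injective.comp e.injective)
  · ext i j
    have h1 : (W * Matrix.diagonal (fun i => ((T.indicator (fun _ => (1 : ℝ)) i : ℝ) : ℂ)) * Wᴴ)
        i j = ∑ l, W i l * ((T.indicator (fun _ => (1 : ℝ)) l : ℝ) : ℂ) * star (W j l) := by
      rw [Matrix.mul_apply]
      exact Finset.sum_congr rfl fun l _ => by rw [Matrix.mul_diagonal, Matrix.conjTranspose_apply]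
    refine Eq.trans ?_ h1.symm
    rw [← Finset.sum_subset (Finset.subset_univ T.toFinset) fun l _ hl => by
      rw [Set.mem_toFinset] at hl
      simp [hl]]
    simp only [ContinuousMap.const_apply, Matrix.mul_apply,
      Matrix.submatrix_apply, Matrix.conjTranspose_apply, id]
    rw [e.sum_comp (fun t : T => W i t * star (W j t)),
      Finset.sum_set_coe T (f := fun t => W i t * star (W j t))]
    refine Finset.sum_congr rfl fun l hl => ?_
    rw [Set.mem_toFinset] at hl
    simp [hl]

theorem smul_unitary_conj_diagonal (r : ℝ) (s : Fin n → ℝ) :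
    r • (W * Matrix.diagonal (fun i => (s i : ℂ)) * Wᴴ) =
      W * Matrix.diagonal (fun i => ((r * s i : ℝ) : ℂ)) * Wᴴ := by
  rw [← Matrix.smul_mul, ← Matrix.mul_smul, ← Matrix.diagonal_smul]
  congr 3
  ext i
  simp

/-- As scaling by `β x` moves no eigenvalue into or out of `S`, the projection does not depend on
`x`, and fixed columns of `W` give a frame. -/
theorem isTrivialProjField_spectralProj {X : Type*} [TopologicalSpace X]
    (hW : W ∈ Matrix.unitaryGroup (Fin n) ℂ) (s : Fin n → ℝ) (β : X → ℝ) (S : Set ℝ)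
    (hS : ∀ x i, β x * s i ∈ S ↔ s i ∈ S) :
    IsTrivialProjField fun x => spectralProj S
      (β x • (W * Matrix.diagonal (fun i => (s i : ℂ)) * Wᴴ)) := by
  convert isTrivialProjField_const (X := X) hW (s ⁻¹' S) using 2 with x
  rw [spectralProj, smul_unitary_conj_diagonal, cfc_unitary_conj_diagonal hW]
  congr 3
  ext i
  by_cases hi : s i ∈ S
  · rw [Set.indicator_of_mem ((hS x i).2 hi), Set.indicator_of_mem (show i ∈ s ⁻¹' S from hi)]
  · rw [Set.indicator_of_notMem (fun h => hi ((hS x i).1 h)),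
      Set.indicator_of_notMem (show i ∉ s ⁻¹' S from hi)]

end spectral

/-! ### The two-dimensional correction term -/

section pair

variable {n : ℕ} (a b : Fin n)

/-- The Hermitian matrix with entries `t`, `1`, `1`, `t` in the rows and columns `a`, `b`. -/
noncomputable def pairMatrix (t : ℝ) : Matrix (Fin n) (Fin n) ℂ :=
  Matrix.single a b 1 + Matrix.single b a 1 +
    (t : ℂ) • (Matrix.single a a 1 + Matrix.single b b 1)

/-- A unitary matrix diagonalizing `pairMatrix a b t`. -/
noncomputable def pairUnitary : Matrix (Fin n) (Fin n) ℂ :=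
  1 - Matrix.single a a 1 - Matrix.single b b 1 + (((Real.sqrt 2)⁻¹ : ℝ) : ℂ) •
    (Matrix.single a a 1 + Matrix.single a b 1 + Matrix.single b a 1 - Matrix.single b b 1)

/-- The eigenvalues of `pairMatrix a b t`. -/
def pairEigenvalues (t : ℝ) (i : Fin n) : ℝ := if i = a then t + 1 else if i = b then t - 1 else 0

theorem pairUnitary_conjTranspose : (pairUnitary a b)ᴴ = pairUnitary a b := by
  simp [pairUnitary, Matrix.conjTranspose_add, Matrix.conjTranspose_sub,
    Matrix.conjTranspose_smul]
  module

theorem diagonal_pairEigenvalues {a b : Fin n} (hab : a ≠ b) (t : ℝ) :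
    Matrix.diagonal (fun i => (pairEigenvalues a b t i : ℂ)) =
      ((t : ℂ) + 1) • Matrix.single a a 1 + ((t : ℂ) - 1) • Matrix.single b b 1 := by
  ext i j
  simp only [Matrix.diagonal_apply, pairEigenvalues, Matrix.add_apply, Matrix.smul_apply,
    Matrix.single_apply, smul_eq_mul]
  split_ifs <;> push_cast <;> grind

theorem sqrt_two_inv_mul_self :
    (((Real.sqrt 2)⁻¹ : ℝ) : ℂ) * (((Real.sqrt 2)⁻¹ : ℝ) : ℂ) = 1 / 2 := by
  rw [← Complex.ofReal_mul, ← mul_inv, Real.mul_self_sqrt (by norm_num)]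
  norm_num

theorem pairUnitary_mem_unitaryGroup {a b : Fin n} (hab : a ≠ b) :
    pairUnitary a b ∈ Matrix.unitaryGroup (Fin n) ℂ := by
  rw [Matrix.mem_unitaryGroup_iff, Matrix.star_eq_conjTranspose, pairUnitary_conjTranspose]
  have hs := sqrt_two_inv_mul_self
  unfold pairUnitary
  generalize (((Real.sqrt 2)⁻¹ : ℝ) : ℂ) = s at *
  simp only [mul_add, add_mul, mul_sub, sub_mul, Matrix.one_mul, Matrix.smul_mul,
    Matrix.mul_smul, Matrix.single_mul_single_same, mul_one, ne_eq, hab, hab.symm, not_false_eq_true,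
    Matrix.single_mul_single_of_ne, smul_add, smul_sub, smul_zero, smul_smul, hs]
  module

theorem pairUnitary_conj_diagonal {a b : Fin n} (hab : a ≠ b) (t : ℝ) :
    pairUnitary a b * Matrix.diagonal (fun i => (pairEigenvalues a b t i : ℂ)) *
      (pairUnitary a b)ᴴ = pairMatrix a b t := by
  rw [pairUnitary_conjTranspose, diagonal_pairEigenvalues hab]
  have hs := sqrt_two_inv_mul_self
  unfold pairUnitary pairMatrix
  generalize (((Real.sqrt 2)⁻¹ : ℝ) : ℂ) = s at *
  have hs' : ∀ z : ℂ, s * (z * s) = z / 2 := fun z => by linear_combination z * hs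
  simp only [mul_add, add_mul, mul_sub, sub_mul, Matrix.one_mul, Matrix.smul_mul,
    Matrix.mul_smul, Matrix.single_mul_single_same, mul_one, ne_eq, hab, hab.symm, not_false_eq_true,
    Matrix.single_mul_single_of_ne, smul_add, smul_sub, smul_zero, smul_smul, hs',
    Matrix.zero_mul]
  module

theorem rank_unitary_conj_diagonal {W : Matrix (Fin n) (Fin n) ℂ}
    (hW : W ∈ Matrix.unitaryGroup (Fin n) ℂ) (μ : Fin n → ℝ) :
    (W * Matrix.diagonal (fun i => (μ i : ℂ)) * Wᴴ).rank =
      (Finset.univ.filter fun i => μ i ≠ 0).card := by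
  have h1 : IsUnit W.det := by
    rw [← Matrix.isUnit_iff_isUnit_det]
    exact ⟨Unitary.toUnits ⟨W, hW⟩, rfl⟩
  have h2 : IsUnit Wᴴ.det := by
    rw [Matrix.det_conjTranspose]
    exact h1.star
  rw [Matrix.rank_mul_eq_left_of_isUnit_det _ _ h2, Matrix.rank_mul_eq_right_of_isUnit_det _ _ h1,
    Matrix.rank_diagonal, Fintype.card_subtype]
  simp

theorem frobNorm_diagonal_sq (v : Fin n → ℂ) :
    frobNorm (Matrix.diagonal v) ^ 2 = ∑ i, ‖v i‖ ^ 2 := by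
  rw [frobNorm_sq]
  refine Finset.sum_congr rfl fun i _ => ?_
  rw [Finset.sum_eq_single i] <;> simp +contextual [eq_comm]

theorem frobNorm_pairMatrix_sq {a b : Fin n} (hab : a ≠ b) (t : ℝ) :
    frobNorm (pairMatrix a b t) ^ 2 = (t + 1) ^ 2 + (t - 1) ^ 2 := by
  rw [← pairUnitary_conj_diagonal hab, frobNorm_unitary_conj (pairUnitary_mem_unitaryGroup hab),
    frobNorm_diagonal_sq]
  have : ∀ i, ‖(pairEigenvalues a b t i : ℂ)‖ ^ 2 =
      (if i = a then (t + 1) ^ 2 else 0) + if i = b then (t - 1) ^ 2 else 0 := by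
    intro i
    rw [Complex.norm_real, Real.norm_eq_abs, sq_abs, pairEigenvalues]
    split_ifs with h1 h2
    · exact absurd (h1.symm.trans h2) hab
    · simp
    · simp
    · simp
  simp only [this, Finset.sum_add_distrib, Finset.sum_ite_eq', Finset.mem_univ, if_true]

theorem opNorm_pairMatrix_le {a b : Fin n} (hab : a ≠ b) (t : ℝ) :
    opNorm (pairMatrix a b t) ≤ 1 + |t| := by
  rw [← pairUnitary_conj_diagonal hab, opNorm_unitary_conj (pairUnitary_mem_unitaryGroup hab),
    opNorm_diagonal, pi_norm_le_iff_of_nonneg (by positivity)]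
  intro i
  rw [Complex.norm_real, Real.norm_eq_abs, pairEigenvalues]
  have h1 := le_abs_self t
  have h2 := neg_abs_le t
  split_ifs
  · exact abs_le.2 ⟨by linarith, by linarith⟩
  · exact abs_le.2 ⟨by linarith, by linarith⟩
  · simp; positivity

/-- An off-diagonal entry of a Hermitian matrix occurs twice; this makes the Frobenius bounds on `q`
sharper by a factor `√2`. -/
theorem two_mul_norm_sq_le_frobNorm_sq {A : Matrix (Fin n) (Fin n) ℂ} (hA : A.IsHermitian)
    {a b : Fin n} (hab : a ≠ b) : 2 * ‖A b a‖ ^ 2 ≤ frobNorm A ^ 2 := by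
  have h1 : ‖A a b‖ = ‖A b a‖ := by rw [← hA.apply, norm_star]
  rw [frobNorm_sq, ← Fintype.sum_prod_type' fun i j => ‖A i j‖ ^ 2]
  have h2 := Finset.sum_le_sum_of_subset_of_nonneg (f := fun p : Fin n × Fin n => ‖A p.1 p.2‖ ^ 2)
    (Finset.subset_univ {(a, b), (b, a)}) fun p _ _ => by positivity
  rw [Finset.sum_pair (by simp [hab])] at h2
  simp only [h1] at h2
  linarith

theorem smul_pairMatrix_eq {a b : Fin n} (hab : a ≠ b) (r t : ℝ) :
    r • pairMatrix a b t = pairUnitary a b *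
      Matrix.diagonal (fun i => ((r * pairEigenvalues a b t i : ℝ) : ℂ)) * (pairUnitary a b)ᴴ := by
  rw [← pairUnitary_conj_diagonal hab, smul_unitary_conj_diagonal]

theorem smul_pairMatrix_isHermitian {a b : Fin n} (hab : a ≠ b) (r t : ℝ) :
    (r • pairMatrix a b t).IsHermitian := by
  rw [smul_pairMatrix_eq hab]
  exact Matrix.isHermitian_mul_mul_conjTranspose _
    (Matrix.isHermitian_diagonal_of_self_adjoint _ (by ext i; simp))

theorem smul_pairMatrix_posSemidef {a b : Fin n} (hab : a ≠ b) {r t : ℝ}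
    (h : ∀ i, 0 ≤ r * pairEigenvalues a b t i) : (r • pairMatrix a b t).PosSemidef := by
  rw [smul_pairMatrix_eq hab]
  refine Matrix.PosSemidef.mul_mul_conjTranspose_same (Matrix.PosSemidef.diagonal fun i => ?_) _
  exact Complex.zero_le_real.2 (h i)

end pair

/-! ### Block sums -/

section blockSum

variable {k c n : ℕ} (h : k + c = n)

/-- The position in `Fin n` of an index of the top-left block. -/
def leftIdx (i : Fin k) : Fin n := Fin.cast h (Fin.castAdd c i)

/-- The position in `Fin n` of an index of the bottom-right block. -/
def rightIdx (i : Fin c) : Fin n := Fin.cast h (Fin.natAdd k i)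

@[simp] theorem leftIdx_val (i : Fin k) : (leftIdx h i : ℕ) = i := rfl

@[simp] theorem rightIdx_val (i : Fin c) : (rightIdx h i : ℕ) = k + i := rfl

@[simp] theorem leftIdx_inj {i j : Fin k} : leftIdx h i = leftIdx h j ↔ i = j := by
  simp [Fin.ext_iff]

@[simp] theorem rightIdx_inj {i j : Fin c} : rightIdx h i = rightIdx h j ↔ i = j := by
  simp [Fin.ext_iff]

@[simp] theorem leftIdx_ne_rightIdx (i : Fin k) (j : Fin c) : leftIdx h i ≠ rightIdx h j := by
  simp [Fin.ext_iff]
  omega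

@[simp] theorem rightIdx_ne_leftIdx (i : Fin c) (j : Fin k) : rightIdx h i ≠ leftIdx h j :=
  (leftIdx_ne_rightIdx h j i).symm

variable (a : Matrix (Fin k) (Fin k) ℂ) (b : Matrix (Fin c) (Fin c) ℂ)

@[simp] theorem blockSum_left_left (i j : Fin k) :
    blockSum h a b (leftIdx h i) (leftIdx h j) = a i j := by
  subst h
  simp [blockSum, leftIdx]

@[simp] theorem blockSum_right_right (i j : Fin c) :
    blockSum h a b (rightIdx h i) (rightIdx h j) = b i j := by
  subst h
  simp [blockSum, rightIdx]

@[simp] theorem blockSum_left_right (i : Fin k) (j : Fin c) :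
    blockSum h a b (leftIdx h i) (rightIdx h j) = 0 := by
  subst h
  simp [blockSum, leftIdx, rightIdx]

@[simp] theorem blockSum_right_left (i : Fin c) (j : Fin k) :
    blockSum h a b (rightIdx h i) (leftIdx h j) = 0 := by
  subst h
  simp [blockSum, leftIdx, rightIdx]

theorem idx_cases {p : Fin n → Prop} (hl : ∀ i, p (leftIdx h i)) (hr : ∀ i, p (rightIdx h i))
    (i : Fin n) : p i := by
  subst h
  exact Fin.addCases hl hr i

theorem eq_blockSum {A : Matrix (Fin n) (Fin n) ℂ}
    (hll : ∀ i j, A (leftIdx h i) (leftIdx h j) = a i j)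
    (hlr : ∀ i j, A (leftIdx h i) (rightIdx h j) = 0)
    (hrl : ∀ i j, A (rightIdx h i) (leftIdx h j) = 0)
    (hrr : ∀ i j, A (rightIdx h i) (rightIdx h j) = b i j) : A = blockSum h a b := by
  ext i j
  refine idx_cases h (p := fun i => A i j = blockSum h a b i j) (fun i => ?_) (fun i => ?_) i
  · refine idx_cases h (p := fun j => A (leftIdx h i) j = blockSum h a b (leftIdx h i) j)
      (fun j => ?_) (fun j => ?_) j
    · rw [hll, blockSum_left_left]
    · rw [hlr, blockSum_left_right]
  · refine idx_cases h (p := fun j => A (rightIdx h i) j = blockSum h a b (rightIdx h i) j)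
      (fun j => ?_) (fun j => ?_) j
    · rw [hrl, blockSum_right_left]
    · rw [hrr, blockSum_right_right]

theorem blockSum_mul (a' : Matrix (Fin k) (Fin k) ℂ) (b' : Matrix (Fin c) (Fin c) ℂ) :
    blockSum h a b * blockSum h a' b' = blockSum h (a * a') (b * b') := by
  simp only [blockSum, Matrix.reindex_apply]
  rw [Matrix.submatrix_mul_equiv, Matrix.fromBlocks_multiply]
  simp

theorem blockSum_zero_zero :
    blockSum h (0 : Matrix (Fin k) (Fin k) ℂ) (0 : Matrix (Fin c) (Fin c) ℂ) = 0 := by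
  simp [blockSum]

theorem blockSum_conjTranspose : (blockSum h a b)ᴴ = blockSum h aᴴ bᴴ := by
  simp [blockSum, Matrix.fromBlocks_conjTranspose]

theorem blockSum_add (a' : Matrix (Fin k) (Fin k) ℂ) (b' : Matrix (Fin c) (Fin c) ℂ) :
    blockSum h a b + blockSum h a' b' = blockSum h (a + a') (b + b') :=
  eq_blockSum h _ _ (by simp) (by simp) (by simp) (by simp)

theorem sum_smul_blockSum {ι : Type*} (s : Finset ι) (r : ι → ℝ)
    (A : ι → Matrix (Fin k) (Fin k) ℂ) :
    ∑ i ∈ s, r i • blockSum h (A i) 0 = blockSum h (∑ i ∈ s, r i • A i) 0 :=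
  eq_blockSum h _ _ (by simp [Matrix.sum_apply]) (by simp [Matrix.sum_apply])
    (by simp [Matrix.sum_apply]) (by simp [Matrix.sum_apply])

theorem continuous_blockSum {X : Type*} [TopologicalSpace X]
    {A : X → Matrix (Fin k) (Fin k) ℂ} {B : X → Matrix (Fin c) (Fin c) ℂ} (hA : Continuous A)
    (hB : Continuous B) : Continuous fun x => blockSum h (A x) (B x) :=
  (hA.matrix_fromBlocks continuous_const continuous_const hB).matrix_reindex _ _

open scoped MatrixOrder Matrix.Norms.L2Operator in
variable {a b} in
theorem blockSum_posSemidef (ha : a.PosSemidef) (hb : b.PosSemidef) :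
    (blockSum h a b).PosSemidef := by
  obtain ⟨a', rfl⟩ := CStarAlgebra.nonneg_iff_eq_star_mul_self.1 ha.nonneg
  obtain ⟨b', rfl⟩ := CStarAlgebra.nonneg_iff_eq_star_mul_self.1 hb.nonneg
  rw [Matrix.star_eq_conjTranspose, Matrix.star_eq_conjTranspose, ← blockSum_mul,
    ← blockSum_conjTranspose]
  exact Matrix.posSemidef_conjTranspose_mul_self _

theorem isTrivialProjField_blockSum_one_zero {X : Type*} [TopologicalSpace X] :
    IsTrivialProjField fun _ : X => blockSum h 1 0 := by
  convert isTrivialProjField_const (X := X) (n := n) (W := 1) (Submonoid.one_mem _)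
    (Set.range (leftIdx h)) using 2
  rw [Matrix.conjTranspose_one, Matrix.mul_one, Matrix.one_mul]
  refine (eq_blockSum h _ _ (fun i j => ?_) (fun i j => ?_) (fun i j => ?_) fun i j => ?_).symm
  · simp [Matrix.diagonal_apply, Matrix.one_apply]
  · simp
  · simp
  · simp [Matrix.diagonal_apply]

theorem rank_blockSum_vecMulVec {w : Fin k → ℂ} (hw : w ≠ 0) :
    (blockSum h (Matrix.vecMulVec w (star w)) 0).rank = 1 := by
  obtain ⟨i, hi⟩ := Function.ne_iff.1 hw
  refine le_antisymm ?_ (Nat.one_le_iff_ne_zero.2 fun h0 => ?_)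
  · let v : Fin n → ℂ := fun j => if hj : (j : ℕ) < k then w ⟨j, hj⟩ else 0
    have : blockSum h (Matrix.vecMulVec w (star w)) 0 = Matrix.vecMulVec v (star v) :=
      (eq_blockSum h _ _ (by simp [Matrix.vecMulVec_apply, v])
        (by simp [Matrix.vecMulVec_apply, v]) (by simp [Matrix.vecMulVec_apply, v])
        (by simp [Matrix.vecMulVec_apply, v])).symm
    rw [this]
    exact Matrix.rank_vecMulVec_le _ _
  · rw [Matrix.rank, Submodule.finrank_eq_zero, LinearMap.range_eq_bot] at h0
    have := congrFun (LinearMap.congr_fun h0 (Pi.single (leftIdx h i) 1)) (leftIdx h i)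
    rw [Matrix.mulVecLin_apply, Matrix.mulVec_single_one, Matrix.col_apply, blockSum_left_left,
      Matrix.vecMulVec_apply] at this
    simp at this
    exact hi this

end blockSum

/-! ### Splitting a tridiagonalized field -/

/-- Below the diagonal, the only entry joining the two blocks is `β`, in the last column of the
first block; subtracting `q` cancels it. Since `q` changes the first block only on its diagonal, the
Jacobi property of that block survives for every `t`. -/
theorem exists_isFieldDecomposition {X : Type*} [TopologicalSpace X] {k c n : ℕ} (h : k + c = n)
    (g : C(X, Matrix (Fin n) (Fin n) ℂ)) (hg : ∀ x, (g x).IsHermitian)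
    (htri : ∀ x (i j : Fin n), (i : ℕ) < k →
      ((j : ℕ) = i + 1 → 0 < g x j i) ∧ ((i : ℕ) + 1 < j → g x j i = 0))
    {a : Fin k} (ha : (a : ℕ) + 1 = k) {b : Fin c} (hb : (b : ℕ) = 0)
    (β : C(X, ℝ)) (hβ : ∀ x, 0 < β x) (hgβ : ∀ x, g x (rightIdx h b) (leftIdx h a) = β x)
    (t : ℝ) :
    ∃ (lam : Fin k → C(X, ℝ)) (p : Fin k → C(X, Matrix (Fin n) (Fin n) ℂ))
      (r q : C(X, Matrix (Fin n) (Fin n) ℂ)), IsFieldDecomposition h g lam p r q ∧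
      (∀ x, q x = β x • pairMatrix (leftIdx h a) (rightIdx h b) t) ∧
      ((∀ x, ((g x - q x).submatrix (leftIdx h) (leftIdx h)).PosSemidef ∧
          ((g x - q x).submatrix (rightIdx h) (rightIdx h)).PosSemidef) →
        ∀ x, (r x).PosSemidef ∧ ∀ i, (p i x).PosSemidef ∧ 0 ≤ lam i x) := by
  have hab : leftIdx h a ≠ rightIdx h b := leftIdx_ne_rightIdx h a b
  let q : C(X, Matrix (Fin n) (Fin n) ℂ) :=
    ⟨fun x => β x • pairMatrix (leftIdx h a) (rightIdx h b) t,
      β.continuous.smul continuous_const⟩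
  have hq : ∀ x, q x = β x • pairMatrix (leftIdx h a) (rightIdx h b) t := fun x => rfl
  have hqh : ∀ x, (q x).IsHermitian := fun x => smul_pairMatrix_isHermitian hab _ _
  have hgq : ∀ x, (g x - q x).IsHermitian := fun x => (hg x).sub (hqh x)
  have hgqc : Continuous fun x => g x - q x := g.continuous.sub q.continuous
  let J : X → Matrix (Fin k) (Fin k) ℂ := fun x => (g x - q x).submatrix (leftIdx h) (leftIdx h)
  let R : X → Matrix (Fin c) (Fin c) ℂ := fun x => (g x - q x).submatrix (rightIdx h) (rightIdx h)
  have hJc : Continuous J := hgqc.matrix_submatrix _ _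
  have hRc : Continuous R := hgqc.matrix_submatrix _ _
  have hJh : ∀ x, (J x).IsHermitian := fun x => (hgq x).submatrix _
  have hRh : ∀ x, (R x).IsHermitian := fun x => (hgq x).submatrix _
  have hqrl : ∀ x i j, (g x - q x) (rightIdx h i) (leftIdx h j) = 0 := by
    intro x i j
    rw [Matrix.sub_apply, hq, Matrix.smul_apply]
    by_cases hij : b = i ∧ a = j
    · obtain ⟨rfl, rfl⟩ := hij
      rw [hgβ]
      simp [pairMatrix]
    · have h1 : g x (rightIdx h i) (leftIdx h j) = 0 := by
        refine (htri x _ _ (by simp)).2 ?_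
        rw [Fin.ext_iff, Fin.ext_iff] at hij
        rw [leftIdx_val, rightIdx_val]
        omega
      simp [pairMatrix, h1, hij]
  have hblock : ∀ x, g x - q x = blockSum h (J x) (R x) := fun x =>
    eq_blockSum h _ _ (fun _ _ => rfl)
      (fun i j => by rw [← (hgq x).apply, hqrl, star_zero]) (hqrl x) (fun _ _ => rfl)
  have hJJ : ∀ x, IsJacobi (J x) := by
    intro x i j
    have hqij : i ≠ j → q x (leftIdx h j) (leftIdx h i) = 0 := fun hij => by
      rw [hq]
      have : ¬(a = j ∧ a = i) := fun h => hij (h.2.symm.trans h.1)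
      simp [pairMatrix, this]
    refine ⟨fun hij => ?_, fun hij => ?_⟩
    · change g x (leftIdx h j) (leftIdx h i) - q x (leftIdx h j) (leftIdx h i) ≠ 0
      rw [hqij (by rintro rfl; omega), sub_zero]
      exact ((htri x (leftIdx h i) (leftIdx h j) i.2).1 hij).ne'
    · change g x (leftIdx h j) (leftIdx h i) - q x (leftIdx h j) (leftIdx h i) = 0
      rw [hqij (by rintro rfl; omega), sub_zero]
      exact (htri x (leftIdx h i) (leftIdx h j) i.2).2 hij
  choose μ w hμw using fun x => (hJh x).exists_isEigenSystem
  have hcont := continuous_eigenSystem hJc hJh hJJ hμw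
  let P : Fin k → X → Matrix (Fin k) (Fin k) ℂ := fun i x =>
    Matrix.vecMulVec (w x i) (star (w x i))
  have hPh : ∀ i x, (P i x)ᴴ = P i x := fun i x => by
    rw [Matrix.conjTranspose_vecMulVec, star_star]
  have hPmul : ∀ i j x, P i x * P j x = if i = j then P i x else 0 := fun i j x => by
    rw [Matrix.vecMulVec_mul_vecMulVec, (hμw x).orthonormal]
    split_ifs with hij
    · rw [one_smul, hij]
    · rw [zero_smul, Matrix.vecMulVec_zero]
  refine ⟨fun i => ⟨fun x => μ x i, (hcont i).1⟩,
    fun i => ⟨fun x => blockSum h (P i x) 0, continuous_blockSum h (hcont i).2 continuous_const⟩,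
    ⟨fun x => blockSum h 0 (R x), continuous_blockSum h continuous_const hRc⟩, q,
    ⟨fun x => ?_, fun i x => ⟨?_, ?_⟩, fun i x => rank_blockSum_vecMulVec h ((hμw x).ne_zero i),
      fun i j hij x => ?_, fun i x => ⟨?_, ?_⟩, ⟨⟨R, hRc⟩, hRh, fun x => rfl⟩, hqh,
      ⟨?_, ?_, ?_⟩, ?_, fun x => ?_, fun x => (hμw x).strictAnti (hJh x) (hJJ x)⟩, hq,
    fun hpos x => ⟨blockSum_posSemidef h Matrix.PosSemidef.zero (hpos x).2, fun i =>
      ⟨blockSum_posSemidef h ?_ Matrix.PosSemidef.zero, (hμw x).nonneg (hpos x).1 i⟩⟩⟩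
  · simp only [ContinuousMap.coe_mk]
    rw [sum_smul_blockSum, ← (hμw x).eq_sum, blockSum_add, add_zero, zero_add, ← hblock,
      sub_add_cancel]
  · change blockSum h _ _ * blockSum h _ _ = blockSum h _ _
    rw [blockSum_mul, hPmul, if_pos rfl, mul_zero]
  · change (blockSum h _ _)ᴴ = blockSum h _ _
    rw [blockSum_conjTranspose, hPh, Matrix.conjTranspose_zero]
  · simp only [ContinuousMap.coe_mk]
    rw [blockSum_mul, hPmul, if_neg hij, mul_zero, blockSum_zero_zero]
  · simp only [ContinuousMap.coe_mk]
    rw [blockSum_mul, mul_zero, zero_mul, blockSum_zero_zero]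
  · simp only [ContinuousMap.coe_mk]
    rw [blockSum_mul, mul_zero, zero_mul, blockSum_zero_zero]
  · simp only [hq, ← pairUnitary_conj_diagonal hab]
    exact isTrivialProjField_spectralProj (pairUnitary_mem_unitaryGroup hab) _ _ _ fun x i =>
      mul_pos_iff_of_pos_left (hβ x)
  · simp only [hq, ← pairUnitary_conj_diagonal hab]
    exact isTrivialProjField_spectralProj (pairUnitary_mem_unitaryGroup hab) _ _ _ fun x i => by
      simp [mul_neg_iff, hβ x, (hβ x).not_gt]
  · simp only [hq, ← pairUnitary_conj_diagonal hab]
    exact isTrivialProjField_spectralProj (pairUnitary_mem_unitaryGroup hab) _ _ _ fun x i => by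
      simp [(hβ x).ne']
  · have : ∀ x, ∑ i, blockSum h (P i x) 0 = blockSum h 1 0 := fun x => by
      have := sum_smul_blockSum h Finset.univ (fun _ => 1) fun i => P i x
      simpa [P, (hμw x).sum_vecMulVec] using this
    simp only [ContinuousMap.coe_mk, this]
    exact isTrivialProjField_blockSum_one_zero h
  · have := sum_smul_blockSum h Finset.univ (fun _ => 1) fun i => P i x
    simpa [P, (hμw x).sum_vecMulVec] using this
  · exact Matrix.posSemidef_vecMulVec_self_star _

/-! ### Variable tolerance, positivity and the main theorem -/

theorem hasCoveringDimLE_of_coveringDim_eq {X : Type*} [TopologicalSpace X] {d : ℕ}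
    (hd : coveringDim X = d) : HasCoveringDimLE X d := by
  have h1 : coveringDim X < ((d + 1 : ℕ) : ℕ∞) := by
    rw [hd]
    exact_mod_cast Nat.lt_succ_self d
  simp only [coveringDim, iInf_lt_iff] at h1
  obtain ⟨e, he, hlt⟩ := h1
  have hed : (d : ℕ∞) ≤ e := hd ▸ iInf₂_le (f := fun e (_ : HasCoveringDimLE X e) => (e : ℕ∞)) e he
  have : e = d := le_antisymm (Nat.lt_succ_iff.1 (by exact_mod_cast hlt)) (by exact_mod_cast hed)
  exact this ▸ he

/-- A field of Hermitian matrices is, up to a unitary and a small perturbation preserving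
positivity, tridiagonal in its first `k` rows and columns. -/
theorem HasCoveringDimLE.exists_tridiagonal_near {X : Type*} [TopologicalSpace X] [NormalSpace X]
    {d : ℕ} (hX : HasCoveringDimLE X d) {c' k n : ℕ} (hd : d ≤ 2 * c') (hn : n = k + c' + 1)
    (f : C(X, Matrix (Fin n) (Fin n) ℂ)) (hf : ∀ x, (f x).IsHermitian)
    (ε : C(X, ℝ)) (hε : ∀ x, 0 < ε x) :
    ∃ (u : C(X, Matrix.unitaryGroup (Fin n) ℂ)) (g : C(X, Matrix (Fin n) (Fin n) ℂ)),
      (∀ x, (g x).IsHermitian) ∧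
      (∀ x, frobNorm ((u x : Matrix (Fin n) (Fin n) ℂ) * f x *
        (u x : Matrix (Fin n) (Fin n) ℂ)ᴴ - g x) < ε x) ∧
      (∀ x, (f x).PosSemidef → (g x).PosSemidef) ∧
      ∀ x (i j : Fin n), (i : ℕ) < k →
        ((j : ℕ) = i + 1 → 0 < g x j i) ∧ ((i : ℕ) + 1 < j → g x j i = 0) := by
  obtain ⟨N, rfl⟩ : ∃ N, n = N + 1 := ⟨k + c', hn⟩
  -- With `n = N + 1`, this solves `δ + n δ = 1`: one `δ` for the tridiagonalization error and at
  -- most `n δ` for the Frobenius norm of the shift `δ • 1`. Working with `f / ε` makes the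
  -- tolerance constant.
  set δ : ℝ := (((N + 1 : ℕ) : ℝ) + 1)⁻¹ with hδdef
  have hδ : 0 < δ := by positivity
  obtain ⟨u, h, -, hh, hfr, htri⟩ := hX.exists_tridiagonal hd k (N := N) (by omega)
    (⟨fun x => (ε x)⁻¹ • f x,
      (ε.continuous.inv₀ fun x => (hε x).ne').smul f.continuous⟩ :
        C(X, Matrix (Fin (N + 1)) (Fin (N + 1)) ℂ))
    (fun x => (hf x).smul (IsSelfAdjoint.all ((ε x)⁻¹))) hδ
  simp only [ContinuousMap.coe_mk] at hfr
  have hone : ∀ r : ℝ, (r • (1 : Matrix (Fin (N + 1)) (Fin (N + 1)) ℂ)).IsHermitian := fun r =>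
    Matrix.isHermitian_one.smul (IsSelfAdjoint.all _)
  -- The shift by `δ` compensates any positivity lost in passing to `h`, and it affects only
  -- diagonal entries, so the tridiagonal pattern is kept.
  refine ⟨u, ⟨fun x => ε x • (h x + δ • (1 : Matrix (Fin (N + 1)) (Fin (N + 1)) ℂ)),
    ε.continuous.smul (h.continuous.add continuous_const)⟩,
    fun x => ((hh x).add (hone _)).smul (IsSelfAdjoint.all _), fun x => ?_, fun x hfx => ?_,
    fun x i j hi => ⟨fun hij => ?_, fun hij => ?_⟩⟩
  · simp only [ContinuousMap.coe_mk]
    set U : Matrix (Fin (N + 1)) (Fin (N + 1)) ℂ := (u x : Matrix (Fin (N + 1)) (Fin (N + 1)) ℂ)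
    have h1 : U * f x * Uᴴ - ε x • (h x + δ • (1 : Matrix (Fin (N + 1)) (Fin (N + 1)) ℂ)) =
        ε x • ((U * ((ε x)⁻¹ • f x) * Uᴴ - h x) + -(δ • (1 : Matrix (Fin (N + 1)) (Fin (N + 1)) ℂ))) := by
      rw [Matrix.mul_smul, Matrix.smul_mul, smul_add, smul_add, smul_sub,
        smul_inv_smul₀ (hε x).ne', smul_neg]
      abel
    have h2 : frobNorm (-(δ • (1 : Matrix (Fin (N + 1)) (Fin (N + 1)) ℂ))) ≤ δ * (N + 1 : ℕ) := by
      rw [frobNorm_neg, frobNorm_smul, abs_of_pos hδ]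
      exact mul_le_mul_of_nonneg_left frobNorm_one_le hδ.le
    have h3 : δ + δ * (N + 1 : ℕ) = 1 := by
      rw [hδdef]
      field_simp
      ring
    rw [h1, frobNorm_smul, abs_of_pos (hε x)]
    refine mul_lt_of_lt_one_right (hε x) ((frobNorm_add_le _ _).trans_lt ?_)
    linarith [hfr x]
  · simp only [ContinuousMap.coe_mk]
    set U : Matrix (Fin (N + 1)) (Fin (N + 1)) ℂ := (u x : Matrix (Fin (N + 1)) (Fin (N + 1)) ℂ)
    have h1 : (U * ((ε x)⁻¹ • f x) * Uᴴ).PosSemidef :=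
      (hfx.smul (inv_nonneg.2 (hε x).le)).mul_mul_conjTranspose_same _
    have h2 : opNorm (h x - U * ((ε x)⁻¹ • f x) * Uᴴ) ≤ δ := by
      rw [← neg_sub, opNorm_neg]
      exact (opNorm_le_frobNorm _).trans (hfr x).le
    have h3 := h1.add (posSemidef_add_smul_one ((hh x).sub h1.isHermitian) h2)
    rw [← add_assoc, add_sub_cancel] at h3
    exact h3.smul (hε x).le
  · have hne : j ≠ i := by
      rintro rfl
      omega
    have := (htri x i j hi).1 hij
    simp only [ContinuousMap.coe_mk, Matrix.smul_apply, Matrix.add_apply, Matrix.one_apply_ne hne,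
      smul_zero, add_zero]
    exact smul_pos (hε x) this
  · have hne : j ≠ i := by
      rintro rfl
      omega
    have := (htri x i j hi).2 hij
    simp only [ContinuousMap.coe_mk, Matrix.smul_apply, Matrix.add_apply, Matrix.one_apply_ne hne,
      smul_zero, add_zero, this]

theorem mainTheorem7 {X : Type*} [TopologicalSpace X] [NormalSpace X]
    (d : ℕ) (hd : coveringDim X = d)
    (n c k : ℕ) (hc : c = ⌈(d : ℝ) / 2⌉₊ + 1) (hn : c < n) (hk : k + c = n)
    (f : C(X, Matrix (Fin n) (Fin n) ℂ)) (hf : ∀ x, (f x).IsHermitian)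
    (ε : C(X, ℝ)) (hε : ∀ x, 0 < ε x) :
    ∃ (u : C(X, Matrix.unitaryGroup (Fin n) ℂ)) (g : C(X, Matrix (Fin n) (Fin n) ℂ)),
      (∀ x, (g x).IsHermitian) ∧
      (∀ x, frobNorm ((u x : Matrix (Fin n) (Fin n) ℂ) * f x
          * (u x : Matrix (Fin n) (Fin n) ℂ)ᴴ - g x) < ε x) ∧
      (∀ x, opNorm ((u x : Matrix (Fin n) (Fin n) ℂ) * f x
          * (u x : Matrix (Fin n) (Fin n) ℂ)ᴴ - g x) < ε x) ∧
      (∃ (lam : Fin k → C(X, ℝ)) (p : Fin k → C(X, Matrix (Fin n) (Fin n) ℂ))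
          (r q : C(X, Matrix (Fin n) (Fin n) ℂ)),
        IsFieldDecomposition hk g lam p r q ∧
        ∀ x, (q x).rank = 1 ∧ (q x).PosSemidef ∧
          frobNorm (q x) ≤ Real.sqrt 2 * (frobNorm (f x) + ε x) ∧
          opNorm (q x) ≤ 2 * (opNorm (f x) + ε x)) ∧
      (∃ (lam : Fin k → C(X, ℝ)) (p : Fin k → C(X, Matrix (Fin n) (Fin n) ℂ))
          (r q : C(X, Matrix (Fin n) (Fin n) ℂ)),
        IsFieldDecomposition hk g lam p r q ∧
        (∀ x, (q x).rank = 1 ∧ (-q x).PosSemidef ∧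
          frobNorm (q x) ≤ Real.sqrt 2 * (frobNorm (f x) + ε x) ∧
          opNorm (q x) ≤ 2 * (opNorm (f x) + ε x)) ∧
        ((∀ x, (f x).PosSemidef) →
          ∀ x, (r x).PosSemidef ∧ ∀ i, (p i x).PosSemidef ∧ 0 ≤ lam i x)) ∧
      (∃ (lam : Fin k → C(X, ℝ)) (p : Fin k → C(X, Matrix (Fin n) (Fin n) ℂ))
          (r q : C(X, Matrix (Fin n) (Fin n) ℂ)),
        IsFieldDecomposition hk g lam p r q ∧
        (∀ x, (q x).rank = 2 ∧ (q x).trace = 0 ∧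
          frobNorm (q x) ≤ frobNorm (f x) + ε x ∧
          opNorm (q x) ≤ opNorm (f x) + ε x) ∧
        ((∀ x, (f x).PosSemidef) →
          ∀ x, (r x).PosSemidef ∧ ∀ i, (p i x).PosSemidef ∧ 0 ≤ lam i x)) := by

  obtain ⟨u, g, hg, hfr, hpos, htri⟩ :=
    (hasCoveringDimLE_of_coveringDim_eq hd).exists_tridiagonal_near (c' := ⌈(d : ℝ) / 2⌉₊) (k := k)
      (by
        have := Nat.le_ceil ((d : ℝ) / 2)
        have h2 : (d : ℝ) ≤ 2 * (⌈(d : ℝ) / 2⌉₊ : ℝ) := by linarith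
        exact_mod_cast h2) (by omega) f hf ε hε
  -- Last index of the first block and first index of the second; `k ≥ 1` because `c < n`.
  let a : Fin k := ⟨k - 1, by omega⟩
  let b : Fin c := ⟨0, by omega⟩
  have ha : (a : ℕ) + 1 = k := Nat.sub_add_cancel (by omega)
  have hab : leftIdx hk a ≠ rightIdx hk b := leftIdx_ne_rightIdx hk a b
  have hgpos : ∀ x, 0 < g x (rightIdx hk b) (leftIdx hk a) := fun x =>
    (htri x (leftIdx hk a) (rightIdx hk b) a.2).1 ha.symm
  let β : C(X, ℝ) := ⟨fun x => (g x (rightIdx hk b) (leftIdx hk a)).re,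
    Complex.continuous_re.comp (g.continuous.matrix_elem _ _)⟩
  have hβ : ∀ x, 0 < β x := fun x => (Complex.pos_iff.1 (hgpos x)).1
  have hgβ : ∀ x, g x (rightIdx hk b) (leftIdx hk a) = β x := fun x =>
    Complex.ext rfl (Complex.pos_iff.1 (hgpos x)).2.symm
  have hop : ∀ x, opNorm ((u x : Matrix (Fin n) (Fin n) ℂ) * f x
      * (u x : Matrix (Fin n) (Fin n) ℂ)ᴴ - g x) < ε x := fun x =>
    (opNorm_le_frobNorm _).trans_lt (hfr x)
  have hgfrob : ∀ x, frobNorm (g x) ≤ frobNorm (f x) + ε x := fun x => by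
    have h1 := frobNorm_add_le ((u x : Matrix (Fin n) (Fin n) ℂ) * f x
      * (u x : Matrix (Fin n) (Fin n) ℂ)ᴴ) (-((u x : Matrix (Fin n) (Fin n) ℂ) * f x
      * (u x : Matrix (Fin n) (Fin n) ℂ)ᴴ - g x))
    rw [frobNorm_neg, frobNorm_unitary_conj (u x).2, neg_sub, add_sub_cancel] at h1
    exact h1.trans (add_le_add le_rfl (hfr x).le)
  have hgop : ∀ x, opNorm (g x) ≤ opNorm (f x) + ε x := fun x => by
    have h1 := opNorm_add_le ((u x : Matrix (Fin n) (Fin n) ℂ) * f x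
      * (u x : Matrix (Fin n) (Fin n) ℂ)ᴴ) (-((u x : Matrix (Fin n) (Fin n) ℂ) * f x
      * (u x : Matrix (Fin n) (Fin n) ℂ)ᴴ - g x))
    rw [opNorm_neg, opNorm_unitary_conj (u x).2, neg_sub, add_sub_cancel] at h1
    exact h1.trans (add_le_add le_rfl (hop x).le)
  have hnorm : ∀ x, ‖g x (rightIdx hk b) (leftIdx hk a)‖ = β x := fun x => by
    rw [hgβ, Complex.norm_real, Real.norm_of_nonneg (hβ x).le]
  have hβop : ∀ x, β x ≤ opNorm (f x) + ε x := fun x =>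
    (hnorm x ▸ norm_apply_le_opNorm _ _ _).trans (hgop x)
  have hβfrob : ∀ x, Real.sqrt 2 * β x ≤ frobNorm (f x) + ε x := fun x => by
    refine le_trans (le_of_sq_le_sq ?_ (frobNorm_nonneg _)) (hgfrob x)
    rw [mul_pow, Real.sq_sqrt (by norm_num), ← hnorm]
    exact two_mul_norm_sq_le_frobNorm_sq (hg x) hab
  have hqop : ∀ x t, opNorm (β x • pairMatrix (leftIdx hk a) (rightIdx hk b) t) ≤
      (1 + |t|) * (opNorm (f x) + ε x) := fun x t => by
    rw [opNorm_smul, abs_of_pos (hβ x), mul_comm]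
    exact mul_le_mul (opNorm_pairMatrix_le hab t) (hβop x) (hβ x).le (by positivity)
  have hqfrob : ∀ x t, frobNorm (β x • pairMatrix (leftIdx hk a) (rightIdx hk b) t) =
      Real.sqrt (1 + t ^ 2) * (Real.sqrt 2 * β x) := fun x t => by
    have h1 : frobNorm (pairMatrix (leftIdx hk a) (rightIdx hk b) t) =
        Real.sqrt (1 + t ^ 2) * Real.sqrt 2 := by
      rw [← Real.sqrt_mul (by positivity), eq_comm,
        Real.sqrt_eq_iff_eq_sq (by positivity) (frobNorm_nonneg _), frobNorm_pairMatrix_sq hab]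
      ring
    rw [frobNorm_smul, abs_of_pos (hβ x), h1]
    ring
  have hrank : ∀ x t, (β x • pairMatrix (leftIdx hk a) (rightIdx hk b) t).rank =
      (Finset.univ.filter fun i => pairEigenvalues (leftIdx hk a) (rightIdx hk b) t i ≠ 0).card :=
    fun x t => by
      rw [smul_pairMatrix_eq hab, rank_unitary_conj_diagonal (pairUnitary_mem_unitaryGroup hab)]
      simp [(hβ x).ne']
  have hdec := exists_isFieldDecomposition hk g hg htri ha (b := b) rfl β hβ hgβ
  refine ⟨u, g, hg, hfr, hop, ?_, ?_, ?_⟩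
  -- For `t = 1` the eigenvalues of `q` on the pair are `2β` and `0`.
  · obtain ⟨lam, p, r, q, hD, hq, -⟩ := hdec 1
    refine ⟨lam, p, r, q, hD, fun x => ⟨?_, ?_, ?_, ?_⟩⟩
    · rw [hq, hrank, Finset.card_eq_one]
      refine ⟨leftIdx hk a, ?_⟩
      ext i
      rw [Finset.mem_filter, pairEigenvalues]
      simp only [Finset.mem_univ, true_and, Finset.mem_singleton]
      split_ifs <;> simp_all
    · rw [hq]
      refine smul_pairMatrix_posSemidef hab fun i => mul_nonneg (hβ x).le ?_
      unfold pairEigenvalues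
      split_ifs <;> norm_num
    · rw [hq, hqfrob, one_pow, one_add_one_eq_two]
      exact mul_le_mul_of_nonneg_left (hβfrob x) (Real.sqrt_nonneg _)
    · rw [hq]
      refine (hqop x 1).trans_eq ?_
      norm_num
  -- For `t = -1` they are `0` and `-2β`, so `g - q` is a sum of positive matrices when `f` is
  -- positive.
  · obtain ⟨lam, p, r, q, hD, hq, hP⟩ := hdec (-1)
    have hqneg : ∀ x, (-q x).PosSemidef := fun x => by
      rw [hq, ← neg_smul]
      refine smul_pairMatrix_posSemidef hab fun i => ?_
      rw [neg_mul, ← mul_neg]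
      refine mul_nonneg (hβ x).le ?_
      unfold pairEigenvalues
      split_ifs <;> norm_num
    refine ⟨lam, p, r, q, hD, fun x => ⟨?_, hqneg x, ?_, ?_⟩, fun hfpos => hP fun x => ?_⟩
    · rw [hq, hrank, Finset.card_eq_one]
      refine ⟨rightIdx hk b, ?_⟩
      ext i
      rw [Finset.mem_filter, pairEigenvalues]
      simp only [Finset.mem_univ, true_and, Finset.mem_singleton]
      split_ifs <;> (simp_all; try norm_num)
    · rw [hq, hqfrob, neg_one_sq, one_add_one_eq_two]
      exact mul_le_mul_of_nonneg_left (hβfrob x) (Real.sqrt_nonneg _)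
    · rw [hq]
      refine (hqop x (-1)).trans_eq ?_
      norm_num
    · have h1 : (g x - q x).PosSemidef := by
        rw [sub_eq_add_neg]
        exact (hpos x (hfpos x)).add (hqneg x)
      exact ⟨h1.submatrix _, h1.submatrix _⟩
  -- For `t = 0` they are `β` and `-β`. Here `q` vanishes on both diagonal blocks, so the blocks of
  -- `g - q` are principal submatrices of `g` and inherit its positivity.
  · obtain ⟨lam, p, r, q, hD, hq, hP⟩ := hdec 0
    refine ⟨lam, p, r, q, hD, fun x => ⟨?_, ?_, ?_, ?_⟩, fun hfpos => hP fun x => ?_⟩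
    · rw [hq, hrank, Finset.card_eq_two]
      refine ⟨leftIdx hk a, rightIdx hk b, hab, ?_⟩
      ext i
      rw [Finset.mem_filter, pairEigenvalues]
      simp only [Finset.mem_univ, true_and, Finset.mem_singleton, Finset.mem_insert]
      split_ifs <;> simp_all
    · rw [hq]
      simp [pairMatrix, hab, hab.symm]
    · rw [hq, hqfrob]
      simpa using hβfrob x
    · rw [hq]
      simpa using hqop x 0
    · have h1 : (q x).submatrix (leftIdx hk) (leftIdx hk) = 0 := by
        ext i j
        rw [hq]
        simp [pairMatrix]
      have h2 : (q x).submatrix (rightIdx hk) (rightIdx hk) = 0 := by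
        ext i j
        rw [hq]
        simp [pairMatrix]
      rw [Matrix.submatrix_sub, Matrix.submatrix_sub]
      simp only [Pi.sub_apply, h1, h2, sub_zero]
      exact ⟨(hpos x (hfpos x)).submatrix _, (hpos x (hfpos x)).submatrix _⟩
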